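/- Let $G=(V,E)$ be a finite simple graph with $V\neq\emptyset$, and fix a linear order $<$ on $V$. **Clique-width.** A $k$-graph is a graph whose vertices are labeled by $\{1,\dots,k\}$. The clique-width $\mathrm{cwd}(G)$ is the smallest $k\ge 1$ such that $G$ (with some labeling) can be constructed from one-vertex $k$-graphs by the operations: disjoint union; relabeling all labels $i$ to $j$; connecting all vertices labeled $i$ with all vertices labeled $j$ ($i\neq j$). **Derivations.** A template $T$ over $V$ consists of two partitions $\mathrm{cmp}(T)$ and $\mathrm{grp}(T)$ of $V$, whose classes are called components and groups. A derivation of length $t$ is a sequence $(T_0,\dots,T_t)$ of templates such that $|\mathrm{cmp}(T_0)|=|V|$, $|\mathrm{cmp}(T_t)|=1$, $\mathrm{grp}(T_i)$ refines $\mathrm{cmp}(T_i)$ for $0\le i\le t$, and $\mathrm{cmp}(T_{i-1})$ refines $\mathrm{cmp}(T_i)$ and $\mathrm{grp}(T_{i-1})$ refines $\mathrm{grp}(T_i)$ for $1\le i\le t$. It is a derivation of $G$ if for all $1\le i\le t$: * (edge) for distinct $u,v$ with $uv\in E$: if $u,v$ are in the same group of $T_i$, then $u,v$ are in the same component of $T_{i-1}$;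 * (neighborhood) for distinct $u,v,w$ with $uv\in E$, $uw\notin E$: if $v,w$ are in the same group of $T_i$, then $u,v$ are in the same component of $T_{i-1}$; * (path) for distinct $u,v,w,x$ with $uv,uw,vx\in E$, $wx\notin E$: if $u,x$ are in the same group of $T_i$ and $v,w$ are in the same group of $T_i$, then $u,v$ are in the same component of $T_{i-1}$. **The formula $F_{\mathrm{der}}(G,t)$.** It has variables $c_{u,v,i}$ and $g_{u,v,i}$ for $u,v\in V$, $0\le i\le t$ (only those with $u<v$ occur), and is the conjunction of the following clauses, where $\bar y$ denotes the negation of a variable $y$ and, in the last two items, a pair of vertex indices is to be read in increasing order: * for $u<v$: $\bar c_{u,v,0}$; $c_{u,v,t}$; $(c_{u,v,i}\lor\bar g_{u,v,i})$ for $0\le i\le t$; $(\bar c_{u,v,i-1}\lor c_{u,v,i})$ and $(\bar g_{u,v,i-1}\lor g_{u,v,i})$ for $1\le i\le t$; * for $u<v<w$, $0\le i\le t$ and each $y\in\{c,g\}$: $(\bar y_{u,v,i}\lor\bar y_{v,w,i}\lor y_{u,w,i})$, $(\bar y_{u,v,i}\lor\bar y_{u,w,i}\lor y_{v,w,i})$,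 $(\bar y_{u,w,i}\lor\bar y_{v,w,i}\lor y_{u,v,i})$; * for $u<v$ with $uv\in E$, $1\le i\le t$: $(c_{u,v,i-1}\lor\bar g_{u,v,i})$; * for distinct $u,v,w$ with $uv\in E$, $uw\notin E$, $1\le i\le t$: $(c_{u,v,i-1}\lor\bar g_{v,w,i})$; * for distinct $u,v,w,x$ with $uv,uw,vx\in E$, $wx\notin E$, $u<v$, $1\le i\le t$: $(c_{u,v,i-1}\lor\bar g_{u,x,i}\lor\bar g_{v,w,i})$. **The formula $F(G,k,t)$.** It has in addition the variables $l_{v,a,i}$ for $v\in V$, $1\le a\le k$, $0\le i\le t$, and is the conjunction of $F_{\mathrm{der}}(G,t)$ with the clauses: * $(l_{v,1,i}\lor\dots\lor l_{v,k,i})$ for $v\in V$, $0\le i\le t$; * $(\bar l_{v,a,i}\lor\bar l_{v,b,i})$ for $v\in V$, $1\le a<b\le k$, $0\le i\le t$; * $(\bar l_{u,a,i}\lor\bar l_{v,a,i}\lor\bar c_{u,v,i}\lor g_{u,v,i})$, $(\bar l_{u,a,i}\lor l_{v,a,i}\lor\bar g_{u,v,i})$ and $(l_{u,a,i}\lor\bar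 l_{v,a,i}\lor\bar g_{u,v,i})$ for $u<v$, $1\le a\le k$, $0\le i\le t$. Then: 1. For every integer $t>0$, $F_{\mathrm{der}}(G,t)$ is satisfiable if and only if $G$ has a derivation of length $t$. 2. For every integer $k$ with $1\le k\le |V|$ and $t=|V|-k+1$, $F(G,k,t)$ is satisfiable if and only if $\mathrm{cwd}(G)\le k$. -/

import Mathlib

namespace CliqueWidthSAT

/-! ### Propositional formulas in conjunctive normal form -/

/-- A literal over the variables `X`: `(x, true)` is the variable `x`,
`(x, false)` is its negation. -/
abbrev Literal (X : Type*) := X × Bool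

/-- The positive literal `x`. -/
abbrev pos {X : Type*} (x : X) : Literal X := (x, true)

/-- The negated variable `x`. -/
abbrev neg {X : Type*} (x : X) : Literal X := (x, false)

/-- A clause is a finite disjunction of literals. -/
abbrev Clause (X : Type*) := Finset (Literal X)

/-- A CNF formula is a finite conjunction of clauses. -/
abbrev CNF (X : Type*) := Finset (Clause X)

/-- The truth assignment `τ` makes at least one literal of the clause `C` true. -/
def Clause.SatisfiedBy {X : Type*} (C : Clause X) (τ : X → Bool) : Prop :=
  ∃ l ∈ C, τ l.1 = l.2

/-- Some truth assignment satisfies every clause. -/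
def CNF.Satisfiable {X : Type*} (F : CNF X) : Prop :=
  ∃ τ : X → Bool, ∀ C ∈ F, Clause.SatisfiedBy C τ

open Classical in
/-- The same formula, its variables renamed along `f`. -/
noncomputable def CNF.rename {X Y : Type*} (f : X → Y) (F : CNF X) : CNF Y :=
  F.image fun C => C.image fun l => (f l.1, l.2)

/-! ### Clique-width -/

/-- Algebraic terms for `k`-expressions over the vertex set `V`; the `k` labels are the elements
of `Fin k`. -/
inductive KExpr (k : ℕ) (V : Type*) where
  /-- the initial `k`-graph `i(v)` -/
  | init (i : Fin k) (v : V) : KExpr k V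
  /-- disjoint union -/
  | union (φ ψ : KExpr k V) : KExpr k V
  /-- change all labels `i` to `j` -/
  | relabel (i j : Fin k) (hij : i ≠ j) (φ : KExpr k V) : KExpr k V
  /-- connect all vertices labeled `i` with all vertices labeled `j` -/
  | addEdges (i j : Fin k) (hij : i ≠ j) (φ : KExpr k V) : KExpr k V

namespace KExpr

variable {k : ℕ} {V : Type*}

/-- The vertex set of the `k`-graph constructed by an expression. -/
def verts : KExpr k V → Set V
  | init _ v => {v}
  | union φ ψ => φ.verts ∪ ψ.verts
  | relabel _ _ _ φ => φ.verts
  | addEdges _ _ _ φ => φ.verts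

open Classical in
/-- The label of a vertex in the `k`-graph constructed by an expression; only the values on
`verts` are meaningful. -/
noncomputable def label : KExpr k V → V → Fin k
  | init i _, _ => i
  | union φ ψ, u => if u ∈ φ.verts then φ.label u else ψ.label u
  | relabel i j _ φ, u => if φ.label u = i then j else φ.label u
  | addEdges _ _ _ φ, u => φ.label u

/-- Adjacency in the `k`-graph constructed by an expression. -/
def Adj : KExpr k V → V → V → Prop
  | init _ _, _, _ => False
  | union φ ψ, u, v => φ.Adj u v ∨ ψ.Adj u v
  | relabel _ _ _ φ, u, v => φ.Adj u v
  | addEdges i j _ φ, u, v => φ.Adj u v ∨ (u ∈ φ.verts ∧ v ∈ φ.verts ∧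
      ((φ.label u = i ∧ φ.label v = j) ∨ (φ.label u = j ∧ φ.label v = i)))

/-- Every union occurring in the term is a union of vertex-disjoint `k`-graphs. -/
def WellFormed : KExpr k V → Prop
  | init _ _ => True
  | union φ ψ => φ.WellFormed ∧ ψ.WellFormed ∧ Disjoint φ.verts ψ.verts
  | relabel _ _ _ φ => φ.WellFormed
  | addEdges _ _ _ φ => φ.WellFormed

/-- The `k`-expression `φ` defines the graph `G` (the final labels are disregarded). -/
def Defines (φ : KExpr k V) (G : SimpleGraph V) : Prop :=
  φ.WellFormed ∧ φ.verts = Set.univ ∧ ∀ u v, φ.Adj u v ↔ G.Adj u v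

end KExpr

/-- The clique-width of `G`: the least positive `k` such that some `k`-expression defines `G`.
It is `⊤` if there is no such `k`, which happens only if `G` has no vertices. -/
noncomputable def cliqueWidth {V : Type*} (G : SimpleGraph V) : ℕ∞ :=
  sInf ((fun k : ℕ => (k : ℕ∞)) '' {k : ℕ | 0 < k ∧ ∃ φ : KExpr k V, φ.Defines G})

/-! ### Derivations -/

/-- A template: two partitions of the universe `V`, given by their equivalence relations. The
equivalence classes of `cmp` are the components, those of `grp` are the groups. -/
structure Template (V : Type*) where
  cmp : Setoid V
  grp : Setoid V

/-- `(T 0, …, T t)` is a derivation of length `t` over the universe `V`. For setoids `r ≤ s` says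
that the partition of `r` is a refinement of the partition of `s`. -/
structure IsDerivation {V : Type*} {t : ℕ} (T : Fin (t + 1) → Template V) : Prop where
  card_cmp_first : (T 0).cmp.classes.ncard = Nat.card V
  card_cmp_last : (T (Fin.last t)).cmp.classes.ncard = 1
  grp_le_cmp : ∀ i, (T i).grp ≤ (T i).cmp
  cmp_mono : ∀ i : Fin t, (T i.castSucc).cmp ≤ (T i.succ).cmp
  grp_mono : ∀ i : Fin t, (T i.castSucc).grp ≤ (T i.succ).grp

/-- `(T 0, …, T t)` is a derivation of the graph `G`. Here `i : Fin t` stands for the step from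
the template `T i.castSucc` to the next template `T i.succ`. -/
structure IsDerivationOf {V : Type*} {t : ℕ} (T : Fin (t + 1) → Template V)
    (G : SimpleGraph V) : Prop where
  isDerivation : IsDerivation T
  edge_property : ∀ i : Fin t, ∀ u v : V, G.Adj u v →
    (T i.succ).grp u v → (T i.castSucc).cmp u v
  /-- for three distinct vertices (`u ≠ v` and `v ≠ w` follow from the adjacencies) -/
  neighborhood_property : ∀ i : Fin t, ∀ u v w : V, u ≠ w → G.Adj u v → ¬ G.Adj u w →
    (T i.succ).grp v w → (T i.castSucc).cmp u v
  /-- for four distinct vertices (all but `w ≠ x` follow from the adjacencies) -/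
  path_property : ∀ i : Fin t, ∀ u v w x : V, w ≠ x →
    G.Adj u v → G.Adj u w → G.Adj v x → ¬ G.Adj w x →
    (T i.succ).grp u x → (T i.succ).grp v w → (T i.castSucc).cmp u v

/-- `G` has a derivation of length `t`. -/
def HasDerivation {V : Type*} (G : SimpleGraph V) (t : ℕ) : Prop :=
  ∃ T : Fin (t + 1) → Template V, IsDerivationOf T G

/-! ### The formula `F_der(G, t)` -/

/-- The component variables `c_{u,v,i}` and the group variables `g_{u,v,i}`, `0 ≤ i ≤ t`. Only
those with `u < v` occur in the clauses below. -/
inductive DerVar (V : Type*) (t : ℕ) where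
  | c (u v : V) (i : Fin (t + 1)) : DerVar V t
  | g (u v : V) (i : Fin (t + 1)) : DerVar V t
  deriving DecidableEq, Fintype

section DerFormula

variable {V : Type*} [LinearOrder V] (G : SimpleGraph V) (t : ℕ)

open DerVar

/-- Clauses for the conditions on the partitions of a derivation. -/
def partitionClauses : Set (Clause (DerVar V t)) :=
  {C | ∃ u v : V, u < v ∧ C = {neg (c u v 0)}} ∪
  {C | ∃ u v : V, u < v ∧ C = {pos (c u v (Fin.last t))}} ∪
  {C | ∃ u v : V, ∃ i : Fin (t + 1), u < v ∧ C = {pos (c u v i), neg (g u v i)}} ∪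
  {C | ∃ u v : V, ∃ i : Fin t, u < v ∧ C = {neg (c u v i.castSucc), pos (c u v i.succ)}} ∪
  {C | ∃ u v : V, ∃ i : Fin t, u < v ∧ C = {neg (g u v i.castSucc), pos (g u v i.succ)}}

/-- Clauses for the transitivity of being in the same component and in the same group. -/
def transitivityClauses : Set (Clause (DerVar V t)) :=
  {C | ∃ u v w : V, ∃ i : Fin (t + 1), u < v ∧ v < w ∧
    (C = {neg (c u v i), neg (c v w i), pos (c u w i)} ∨
     C = {neg (c u v i), neg (c u w i), pos (c v w i)} ∨
     C = {neg (c u w i), neg (c v w i), pos (c u v i)} ∨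
     C = {neg (g u v i), neg (g v w i), pos (g u w i)} ∨
     C = {neg (g u v i), neg (g u w i), pos (g v w i)} ∨
     C = {neg (g u w i), neg (g v w i), pos (g u v i)})}

/-- Clauses for the edge property. -/
def edgeClauses : Set (Clause (DerVar V t)) :=
  {C | ∃ u v : V, ∃ i : Fin t, u < v ∧ G.Adj u v ∧
    C = {pos (c u v i.castSucc), neg (g u v i.succ)}}

/-- Clauses for the neighborhood property, for three distinct vertices `u`, `v`, `w`. -/
def neighborhoodClauses : Set (Clause (DerVar V t)) :=
  {C | ∃ u v w : V, ∃ i : Fin t, u ≠ w ∧ G.Adj u v ∧ ¬ G.Adj u w ∧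
    C = {pos (c (min u v) (max u v) i.castSucc), neg (g (min v w) (max v w) i.succ)}}

/-- Clauses for the path property, for four distinct vertices `u`, `v`, `w`, `x`. -/
def pathClauses : Set (Clause (DerVar V t)) :=
  {C | ∃ u v w x : V, ∃ i : Fin t, u < v ∧ w ≠ x ∧
    G.Adj u v ∧ G.Adj u w ∧ G.Adj v x ∧ ¬ G.Adj w x ∧
    C = {pos (c u v i.castSucc), neg (g (min u x) (max u x) i.succ),
      neg (g (min v w) (max v w) i.succ)}}

/-- The CNF formula `F_der(G, t)`. -/
noncomputable def derFormula [Finite V] : CNF (DerVar V t) :=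
  have := Fintype.ofFinite V
  (Set.toFinite (partitionClauses t ∪ transitivityClauses t ∪ edgeClauses G t ∪
    neighborhoodClauses G t ∪ pathClauses G t)).toFinset

end DerFormula

/-! ### The formula `F(G, k, t)` of the direct encoding -/

/-- The variables of `F_der(G, t)` together with the variables `l_{v,a,i}` (vertex `v` has group
number `a` in the `i`th template). The group numbers are the elements of `Fin k`. -/
inductive DirectVar (V : Type*) (k t : ℕ) where
  | der (x : DerVar V t) : DirectVar V k t
  | l (v : V) (a : Fin k) (i : Fin (t + 1)) : DirectVar V k t
  deriving DecidableEq, Fintype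

section DirectFormula

variable {V : Type*} [LinearOrder V] (G : SimpleGraph V) (k t : ℕ)

open DirectVar

/-- Every vertex has at least one group number. -/
def atLeastOneClauses : Set (Clause (DirectVar V k t)) :=
  {C | ∃ v : V, ∃ i : Fin (t + 1), C = Finset.univ.image fun a : Fin k => pos (l v a i)}

/-- Every vertex has at most one group number. -/
def atMostOneClauses : Set (Clause (DirectVar V k t)) :=
  {C | ∃ v : V, ∃ a b : Fin k, ∃ i : Fin (t + 1), a < b ∧ C = {neg (l v a i), neg (l v b i)}}

/-- Vertices of the same component with the same group number are in the same group, and vertices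
of the same group have the same group number. -/
def sameNumberClauses : Set (Clause (DirectVar V k t)) :=
  {C | ∃ u v : V, ∃ a : Fin k, ∃ i : Fin (t + 1), u < v ∧
    (C = {neg (l u a i), neg (l v a i), neg (der (.c u v i)), pos (der (.g u v i))} ∨
     C = {neg (l u a i), pos (l v a i), neg (der (.g u v i))} ∨
     C = {pos (l u a i), neg (l v a i), neg (der (.g u v i))})}

open Classical in
/-- The CNF formula `F(G, k, t)`: the clauses of `F_der(G, t)` together with the clauses on group
numbers. -/
noncomputable def directFormula [Finite V] : CNF (DirectVar V k t) :=
  have := Fintype.ofFinite V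
  CNF.rename der (derFormula G t) ∪
    (Set.toFinite (atLeastOneClauses (V := V) k t ∪ atMostOneClauses k t ∪
      sameNumberClauses k t)).toFinset

end DirectFormula

end CliqueWidthSAT

/-! A satisfying assignment is a derivation in disguise. On pairs `u < v` the variables of each
level describe two relations, the transitivity clauses make them equivalence relations, and the
other clauses of `derFormula` are the conditions on a derivation (`satisfied_iff_of_encodes`). The
group numbers add that every component has at most `k` groups, expressed by `Template.HasLabels`.
What remains is that clique-width at most `k` means having such a derivation of length `|V| - k +
1`.

A derivation yields an expression by induction on the level (`Template.Expressible.step`). A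
component of the new template is a union of old ones; its groups serve as labels. Edges between
different old components are inserted between whole groups, and the edge, neighborhood and path
properties say that this is allowed and creates no edge outside `G`.

Conversely, the template of level `i` of an expression has as components the vertex sets of the
maximal subterms with at most `i` nested unions, and as groups the label classes just after the
union. The three properties hold because a later insertion treats equally labeled vertices alike;
`KExpr.Fits` is the invariant that carries this down the term.

The length is then cut (`reach_card_sub_add_one`). Steps that merge no components are dropped. All
levels whose components have at most `k` vertices are replaced by one step with singleton groups.
The next level has a component with more than `k` vertices, hence at most `|V| - k` components, and
each further step loses at least one. Short derivations are padded by repeating the last template.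
-/

namespace CliqueWidthSAT

/-! ### Truth assignments as sequences of templates -/

section Encoding

variable {V : Type*} {t : ℕ}

/-- Each vertex can be given one of `k` numbers so that two vertices of the same component have
the same number exactly if they are in the same group. -/
def Template.HasLabels (k : ℕ) (T : Template V) : Prop :=
  ∃ l : V → Fin k, ∀ u v, T.cmp u v → (l u = l v ↔ T.grp u v)

variable [LinearOrder V]

/-- The variables `c_{u,v,i}` and `g_{u,v,i}` with `u < v` describe the templates `T i`. -/
structure Encodes (τ : DerVar V t → Bool) (T : Fin (t + 1) → Template V) : Prop where
  cmp : ∀ u v i, u < v → (τ (.c u v i) = true ↔ (T i).cmp u v)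
  grp : ∀ u v i, u < v → (τ (.g u v i) = true ↔ (T i).grp u v)

lemma exists_encodes (T : Fin (t + 1) → Template V) :
    ∃ τ : DerVar V t → Bool, Encodes τ T := by
  classical
  refine ⟨fun x => match x with
    | .c u v i => decide ((T i).cmp u v)
    | .g u v i => decide ((T i).grp u v), ?_, ?_⟩ <;> simp

lemma Encodes.cmp_min_max {τ : DerVar V t → Bool} {T : Fin (t + 1) → Template V}
    (h : Encodes τ T) {u v : V} (huv : u ≠ v) (i : Fin (t + 1)) :
    τ (.c (min u v) (max u v) i) = true ↔ (T i).cmp u v := by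
  rcases lt_or_gt_of_ne huv with h' | h'
  · rw [min_eq_left h'.le, max_eq_right h'.le, h.cmp u v i h']
  · rw [min_eq_right h'.le, max_eq_left h'.le, h.cmp v u i h']
    exact Setoid.comm' _

lemma Encodes.grp_min_max {τ : DerVar V t → Bool} {T : Fin (t + 1) → Template V}
    (h : Encodes τ T) {u v : V} (huv : u ≠ v) (i : Fin (t + 1)) :
    τ (.g (min u v) (max u v) i) = true ↔ (T i).grp u v := by
  rcases lt_or_gt_of_ne huv with h' | h'
  · rw [min_eq_left h'.le, max_eq_right h'.le, h.grp u v i h']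
  · rw [min_eq_right h'.le, max_eq_left h'.le, h.grp v u i h']
    exact Setoid.comm' _

lemma partitionClauses_satisfied {τ : DerVar V t → Bool} :
    (∀ C ∈ partitionClauses t, Clause.SatisfiedBy C τ) ↔
      ((∀ u v : V, u < v → ¬ τ (.c u v 0) = true) ∧
        (∀ u v : V, u < v → τ (.c u v (Fin.last t)) = true) ∧
        (∀ u v : V, ∀ i, u < v → τ (.g u v i) = true → τ (.c u v i) = true) ∧
        (∀ u v : V, ∀ i : Fin t, u < v → τ (.c u v i.castSucc) = true →
          τ (.c u v i.succ) = true) ∧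
        (∀ u v : V, ∀ i : Fin t, u < v → τ (.g u v i.castSucc) = true →
          τ (.g u v i.succ) = true)) := by
  constructor
  · intro h
    refine ⟨fun u v huv => ?_, fun u v huv => ?_, fun u v i huv => ?_, fun u v i huv => ?_,
      fun u v i huv => ?_⟩
    · simpa [Clause.SatisfiedBy] using
        h _ (Or.inl <| Or.inl <| Or.inl <| Or.inl ⟨u, v, huv, rfl⟩)
    · simpa [Clause.SatisfiedBy] using
        h _ (Or.inl <| Or.inl <| Or.inl <| Or.inr ⟨u, v, huv, rfl⟩)
    · have := h _ (Or.inl <| Or.inl <| Or.inr ⟨u, v, i, huv, rfl⟩)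
      simp [Clause.SatisfiedBy] at this; grind
    · have := h _ (Or.inl <| Or.inr ⟨u, v, i, huv, rfl⟩)
      simp [Clause.SatisfiedBy] at this; grind
    · have := h _ (Or.inr ⟨u, v, i, huv, rfl⟩)
      simp [Clause.SatisfiedBy] at this; grind
  · rintro ⟨h1, h2, h3, h4, h5⟩ C
      ((((⟨u, v, huv, rfl⟩ | ⟨u, v, huv, rfl⟩) | ⟨u, v, i, huv, rfl⟩) | ⟨u, v, i, huv, rfl⟩) |
        ⟨u, v, i, huv, rfl⟩) <;>
      simp [Clause.SatisfiedBy] <;> grind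

lemma transitivityClauses_satisfied {τ : DerVar V t → Bool} :
    (∀ C ∈ transitivityClauses t, Clause.SatisfiedBy C τ) ↔
      ∀ u v w : V, ∀ i, u < v → v < w →
        ((τ (.c u v i) = true → τ (.c v w i) = true → τ (.c u w i) = true) ∧
        (τ (.c u v i) = true → τ (.c u w i) = true → τ (.c v w i) = true) ∧
        (τ (.c u w i) = true → τ (.c v w i) = true → τ (.c u v i) = true)) ∧
        ((τ (.g u v i) = true → τ (.g v w i) = true → τ (.g u w i) = true) ∧
        (τ (.g u v i) = true → τ (.g u w i) = true → τ (.g v w i) = true) ∧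
        (τ (.g u w i) = true → τ (.g v w i) = true → τ (.g u v i) = true)) := by
  constructor
  · intro h u v w i huv hvw
    refine ⟨⟨?_, ?_, ?_⟩, ?_, ?_, ?_⟩
    · have := h _ ⟨u, v, w, i, huv, hvw, Or.inl rfl⟩
      simp [Clause.SatisfiedBy] at this; grind
    · have := h _ ⟨u, v, w, i, huv, hvw, Or.inr <| Or.inl rfl⟩
      simp [Clause.SatisfiedBy] at this; grind
    · have := h _ ⟨u, v, w, i, huv, hvw, Or.inr <| Or.inr <| Or.inl rfl⟩
      simp [Clause.SatisfiedBy] at this; grind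
    · have := h _ ⟨u, v, w, i, huv, hvw, Or.inr <| Or.inr <| Or.inr <| Or.inl rfl⟩
      simp [Clause.SatisfiedBy] at this; grind
    · have := h _ ⟨u, v, w, i, huv, hvw, Or.inr <| Or.inr <| Or.inr <| Or.inr <| Or.inl rfl⟩
      simp [Clause.SatisfiedBy] at this; grind
    · have := h _ ⟨u, v, w, i, huv, hvw, Or.inr <| Or.inr <| Or.inr <| Or.inr <| Or.inr rfl⟩
      simp [Clause.SatisfiedBy] at this; grind
  · rintro h C ⟨u, v, w, i, huv, hvw, rfl | rfl | rfl | rfl | rfl | rfl⟩ <;>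
      obtain ⟨⟨h1, h2, h3⟩, h4, h5, h6⟩ := h u v w i huv hvw <;>
      simp [Clause.SatisfiedBy] <;> grind

lemma edgeClauses_satisfied {G : SimpleGraph V} {τ : DerVar V t → Bool} :
    (∀ C ∈ edgeClauses G t, Clause.SatisfiedBy C τ) ↔
      ∀ u v : V, ∀ i : Fin t, u < v → G.Adj u v → τ (.g u v i.succ) = true →
        τ (.c u v i.castSucc) = true := by
  constructor
  · intro h u v i huv hG
    have := h _ ⟨u, v, i, huv, hG, rfl⟩
    simp [Clause.SatisfiedBy] at this; grind
  · rintro h C ⟨u, v, i, huv, hG, rfl⟩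
    simp [Clause.SatisfiedBy]; grind

lemma neighborhoodClauses_satisfied {G : SimpleGraph V} {τ : DerVar V t → Bool} :
    (∀ C ∈ neighborhoodClauses G t, Clause.SatisfiedBy C τ) ↔
      ∀ u v w : V, ∀ i : Fin t, u ≠ w → G.Adj u v → ¬ G.Adj u w →
        τ (.g (min v w) (max v w) i.succ) = true →
        τ (.c (min u v) (max u v) i.castSucc) = true := by
  constructor
  · intro h u v w i huw hG hG'
    have := h _ ⟨u, v, w, i, huw, hG, hG', rfl⟩
    simp [Clause.SatisfiedBy] at this; grind
  · rintro h C ⟨u, v, w, i, huw, hG, hG', rfl⟩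
    have := h u v w i huw hG hG'
    simp only [Clause.SatisfiedBy, Finset.mem_insert, Finset.mem_singleton, exists_eq_or_imp,
      exists_eq_left]
    grind

lemma pathClauses_satisfied {G : SimpleGraph V} {τ : DerVar V t → Bool} :
    (∀ C ∈ pathClauses G t, Clause.SatisfiedBy C τ) ↔
      ∀ u v w x : V, ∀ i : Fin t, u < v → w ≠ x → G.Adj u v → G.Adj u w → G.Adj v x →
        ¬ G.Adj w x → τ (.g (min u x) (max u x) i.succ) = true →
        τ (.g (min v w) (max v w) i.succ) = true → τ (.c u v i.castSucc) = true := by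
  constructor
  · intro h u v w x i huv hwx h1 h2 h3 h4
    have := h _ ⟨u, v, w, x, i, huv, hwx, h1, h2, h3, h4, rfl⟩
    simp [Clause.SatisfiedBy] at this; grind
  · rintro h C ⟨u, v, w, x, i, huv, hwx, h1, h2, h3, h4, rfl⟩
    have := h u v w x i huv hwx h1 h2 h3 h4
    simp only [Clause.SatisfiedBy, Finset.mem_insert, Finset.mem_singleton, exists_eq_or_imp,
      exists_eq_left]
    grind

lemma derFormula_satisfied [Finite V] {G : SimpleGraph V} {τ : DerVar V t → Bool} :
    (∀ C ∈ derFormula G t, Clause.SatisfiedBy C τ) ↔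
      (∀ C ∈ partitionClauses t, Clause.SatisfiedBy C τ) ∧
      (∀ C ∈ transitivityClauses t, Clause.SatisfiedBy C τ) ∧
      (∀ C ∈ edgeClauses G t, Clause.SatisfiedBy C τ) ∧
      (∀ C ∈ neighborhoodClauses G t, Clause.SatisfiedBy C τ) ∧
      (∀ C ∈ pathClauses G t, Clause.SatisfiedBy C τ) := by
  simp only [derFormula, Set.Finite.mem_toFinset, Set.mem_union, or_imp, forall_and, and_assoc]

/-- The equivalence relation described by a relation on increasing pairs. -/
def setoidOfLT (p : V → V → Prop)
    (hp : ∀ u v w, u < v → v < w →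
      (p u v → p v w → p u w) ∧ (p u v → p u w → p v w) ∧ (p u w → p v w → p u v)) :
    Setoid V where
  r u v := u = v ∨ (u < v ∧ p u v) ∨ (v < u ∧ p v u)
  iseqv := by
    refine ⟨fun u => Or.inl rfl, by grind, ?_⟩
    rintro u v w (rfl | ⟨h1, h2⟩ | ⟨h1, h2⟩) (rfl | ⟨h3, h4⟩ | ⟨h3, h4⟩)
    · exact Or.inl rfl
    · exact Or.inr (Or.inl ⟨h3, h4⟩)
    · exact Or.inr (Or.inr ⟨h3, h4⟩)
    · exact Or.inr (Or.inl ⟨h1, h2⟩)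
    · exact Or.inr (Or.inl ⟨h1.trans h3, (hp _ _ _ h1 h3).1 h2 h4⟩)
    -- When the middle vertex lies above or below both others, the order of `u` and `w` is open, and
    -- `u = w` may occur.
    · rcases lt_trichotomy u w with h | h | h
      · exact Or.inr (Or.inl ⟨h, (hp _ _ _ h h3).2.2 h2 h4⟩)
      · exact Or.inl h
      · exact Or.inr (Or.inr ⟨h, (hp _ _ _ h h1).2.2 h4 h2⟩)
    · exact Or.inr (Or.inr ⟨h1, h2⟩)
    · rcases lt_trichotomy u w with h | h | h
      · exact Or.inr (Or.inl ⟨h, (hp _ _ _ h1 h).2.1 h2 h4⟩)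
      · exact Or.inl h
      · exact Or.inr (Or.inr ⟨h, (hp _ _ _ h3 h).2.1 h4 h2⟩)
    · exact Or.inr (Or.inr ⟨h3.trans h1, (hp _ _ _ h3 h1).1 h4 h2⟩)

lemma setoidOfLT_apply {p : V → V → Prop} (hp) {u v : V} (h : u < v) :
    setoidOfLT p hp u v ↔ p u v := by
  change (u = v ∨ (u < v ∧ p u v) ∨ (v < u ∧ p v u)) ↔ p u v
  simp [h, h.ne, h.not_gt]

lemma exists_encodes_of_satisfied [Finite V] {G : SimpleGraph V} {τ : DerVar V t → Bool}
    (h : ∀ C ∈ derFormula G t, Clause.SatisfiedBy C τ) :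
    ∃ T : Fin (t + 1) → Template V, Encodes τ T := by
  have h' := transitivityClauses_satisfied.1 (derFormula_satisfied.1 h).2.1
  exact ⟨fun i =>
    { cmp := setoidOfLT (fun u v => τ (.c u v i) = true)
        fun u v w h1 h2 => (h' u v w i h1 h2).1
      grp := setoidOfLT (fun u v => τ (.g u v i) = true)
        fun u v w h1 h2 => (h' u v w i h1 h2).2 },
    fun u v i huv => (setoidOfLT_apply (fun u v w h1 h2 => (h' u v w i h1 h2).1) huv).symm,
    fun u v i huv => (setoidOfLT_apply (fun u v w h1 h2 => (h' u v w i h1 h2).2) huv).symm⟩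

end Encoding

/-! ### Satisfying assignments and derivations -/

lemma ncard_classes {V : Type*} (s : Setoid V) :
    s.classes.ncard = Nat.card (Quotient s) := by
  rw [← Nat.card_coe_set_eq]
  exact (Nat.card_congr (Setoid.quotientEquivClasses s)).symm

lemma ncard_classes_eq_card_iff {V : Type*} [Finite V] (s : Setoid V) :
    s.classes.ncard = Nat.card V ↔ s = ⊥ := by
  rw [ncard_classes]
  constructor
  · intro h
    have hb : Function.Bijective (Quotient.mk s) :=
      (Nat.bijective_iff_surjective_and_card _).2 ⟨Quotient.mk_surjective, h.symm⟩
    ext u v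
    exact ⟨fun h => hb.1 (Quotient.sound h), fun h => by cases h; exact s.refl' u⟩
  · rintro rfl
    exact (Nat.card_eq_of_bijective (Quotient.mk ⊥)
      ⟨fun u v h => Quotient.exact h, Quotient.mk_surjective⟩).symm

lemma ncard_classes_eq_one_iff {V : Type*} [Nonempty V] (s : Setoid V) :
    s.classes.ncard = 1 ↔ s = ⊤ := by
  rw [ncard_classes, Nat.card_eq_one_iff_unique]
  constructor
  · rintro ⟨h, -⟩
    ext u v
    exact ⟨fun _ => trivial, fun _ => Quotient.exact (Subsingleton.elim (Quotient.mk s u) _)⟩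
  · rintro rfl
    refine ⟨⟨fun a b => ?_⟩, ‹Nonempty V›.map (Quotient.mk ⊤)⟩
    induction a, b using Quotient.inductionOn₂
    exact Quotient.sound trivial

lemma le_iff_of_lt {V : Type*} [LinearOrder V] {r s : Setoid V} :
    r ≤ s ↔ ∀ u v, u < v → r u v → s u v := by
  refine ⟨fun h u v _ huv => h huv, fun h u v huv => ?_⟩
  rcases lt_trichotomy u v with h' | rfl | h'
  · exact h u v h' huv
  · exact s.refl' u
  · exact s.symm' (h v u h' (r.symm' huv))

/-- Only pairs `u < v` carry information, which suffices because all relations involved are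
reflexive and symmetric. The distinctness of vertices that the clauses leave implicit follows from
the edges and non-edges. -/
lemma satisfied_iff_of_encodes {V : Type*} [Finite V] [Nonempty V] [LinearOrder V]
    {G : SimpleGraph V} {t : ℕ} {τ : DerVar V t → Bool} {T : Fin (t + 1) → Template V}
    (h : Encodes τ T) :
    (∀ C ∈ derFormula G t, Clause.SatisfiedBy C τ) ↔ IsDerivationOf T G := by
  rw [derFormula_satisfied, partitionClauses_satisfied, transitivityClauses_satisfied,
    edgeClauses_satisfied, neighborhoodClauses_satisfied, pathClauses_satisfied]
  constructor
  · rintro ⟨⟨h1, h2, h3, h4, h5⟩, -, h6, h7, h8⟩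
    refine ⟨⟨?_, ?_, ?_, ?_, ?_⟩, ?_, ?_, ?_⟩
    · rw [ncard_classes_eq_card_iff, eq_bot_iff, le_iff_of_lt]
      exact fun u v huv hr => (h1 u v huv ((h.cmp u v 0 huv).2 hr)).elim
    · rw [ncard_classes_eq_one_iff, eq_top_iff, le_iff_of_lt]
      exact fun u v huv _ => (h.cmp u v _ huv).1 (h2 u v huv)
    · exact fun i => le_iff_of_lt.2 fun u v huv hr =>
        (h.cmp u v _ huv).1 (h3 u v _ huv ((h.grp u v _ huv).2 hr))
    · exact fun i => le_iff_of_lt.2 fun u v huv hr =>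
        (h.cmp u v _ huv).1 (h4 u v _ huv ((h.cmp u v _ huv).2 hr))
    · exact fun i => le_iff_of_lt.2 fun u v huv hr =>
        (h.grp u v _ huv).1 (h5 u v _ huv ((h.grp u v _ huv).2 hr))
    · intro i u v hG hr
      rcases lt_or_gt_of_ne hG.ne with huv | huv
      · exact (h.cmp u v _ huv).1 (h6 u v i huv hG ((h.grp u v _ huv).2 hr))
      · exact Setoid.symm' _ ((h.cmp v u _ huv).1
          (h6 v u i huv hG.symm ((h.grp v u _ huv).2 (Setoid.symm' _ hr))))
    · intro i u v w huw hG hG' hr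
      have hvw : v ≠ w := by rintro rfl; exact hG' hG
      exact (h.cmp_min_max hG.ne _).1 (h7 u v w i huw hG hG' ((h.grp_min_max hvw _).2 hr))
    · intro i u v w x hwx huv huw hvx hwx' hr hr'
      have hux : u ≠ x := by rintro rfl; exact hwx' huw.symm
      have hvw : v ≠ w := by rintro rfl; exact hwx' hvx
      rcases lt_or_gt_of_ne huv.ne with hlt | hlt
      · exact (h.cmp u v _ hlt).1 (h8 u v w x i hlt hwx huv huw hvx hwx'
          ((h.grp_min_max hux _).2 hr) ((h.grp_min_max hvw _).2 hr'))
      -- The path property is invariant under exchanging `u` with `v` and `w` with `x`, so clauses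
      -- for `u < v` are enough.
      · exact Setoid.symm' _ ((h.cmp v u _ hlt).1 (h8 v u x w i hlt hwx.symm huv.symm hvx huw
          (fun hh => hwx' hh.symm) ((h.grp_min_max hvw _).2 hr') ((h.grp_min_max hux _).2 hr)))
  · intro hD
    have hbot := (ncard_classes_eq_card_iff _).1 hD.isDerivation.card_cmp_first
    have htop := (ncard_classes_eq_one_iff _).1 hD.isDerivation.card_cmp_last
    refine ⟨⟨?_, ?_, ?_, ?_, ?_⟩, ?_, ?_, ?_, ?_⟩
    · intro u v huv hr
      rw [h.cmp u v _ huv, hbot] at hr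
      exact huv.ne hr
    · intro u v huv
      rw [h.cmp u v _ huv, htop]
      trivial
    · intro u v i huv
      rw [h.cmp u v _ huv, h.grp u v _ huv]
      exact fun hr => hD.isDerivation.grp_le_cmp i hr
    · intro u v i huv
      rw [h.cmp u v _ huv, h.cmp u v _ huv]
      exact fun hr => hD.isDerivation.cmp_mono i hr
    · intro u v i huv
      rw [h.grp u v _ huv, h.grp u v _ huv]
      exact fun hr => hD.isDerivation.grp_mono i hr
    · intro u v w i huv hvw
      rw [h.cmp u v i huv, h.cmp v w i hvw, h.cmp u w i (huv.trans hvw), h.grp u v i huv,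
        h.grp v w i hvw, h.grp u w i (huv.trans hvw)]
      have key : ∀ s : Setoid V, (s u v → s v w → s u w) ∧ (s u v → s u w → s v w) ∧
          (s u w → s v w → s u v) := fun s =>
        ⟨fun a b => s.trans' a b, fun a b => s.trans' (s.symm' a) b,
          fun a b => s.trans' a (s.symm' b)⟩
      exact ⟨key _, key _⟩
    · intro u v i huv hG
      rw [h.cmp u v _ huv, h.grp u v _ huv]
      exact hD.edge_property i u v hG
    · intro u v w i huw hG hG'
      have hvw : v ≠ w := by rintro rfl; exact hG' hG
      rw [h.cmp_min_max hG.ne, h.grp_min_max hvw]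
      exact hD.neighborhood_property i u v w huw hG hG'
    · intro u v w x i huv hwx h1 h2 h3 h4
      have hux : u ≠ x := by rintro rfl; exact h4 h2.symm
      have hvw : v ≠ w := by rintro rfl; exact h4 h3
      rw [h.cmp u v _ huv, h.grp_min_max hux, h.grp_min_max hvw]
      exact hD.path_property i u v w x hwx h1 h2 h3 h4

theorem derFormula_satisfiable_iff {V : Type*} [Finite V] [Nonempty V] [LinearOrder V]
    (G : SimpleGraph V) (t : ℕ) :
    CNF.Satisfiable (derFormula G t) ↔ HasDerivation G t := by
  constructor
  · rintro ⟨τ, hτ⟩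
    obtain ⟨T, hT⟩ := exists_encodes_of_satisfied hτ
    exact ⟨T, (satisfied_iff_of_encodes hT).1 hτ⟩
  · rintro ⟨T, hT⟩
    obtain ⟨τ, hτ⟩ := exists_encodes T
    exact ⟨τ, (satisfied_iff_of_encodes hτ).2 hT⟩

lemma rename_satisfied {X Y : Type*} (f : X → Y) (F : CNF X) (τ : Y → Bool) :
    (∀ C ∈ F.rename f, Clause.SatisfiedBy C τ) ↔
      ∀ C ∈ F, Clause.SatisfiedBy C (fun x => τ (f x)) := by
  classical
  simp only [CNF.rename, Finset.forall_mem_image]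
  refine forall₂_congr fun C _ => ?_
  simp only [Clause.SatisfiedBy, Finset.mem_image]
  constructor
  · rintro ⟨_, ⟨l, hl, rfl⟩, h⟩
    exact ⟨l, hl, h⟩
  · rintro ⟨l, hl, h⟩
    exact ⟨_, ⟨l, hl, rfl⟩, h⟩

lemma directFormula_satisfied {V : Type*} [Finite V] [LinearOrder V] {G : SimpleGraph V}
    {k t : ℕ} {τ : DirectVar V k t → Bool} :
    (∀ C ∈ directFormula G k t, Clause.SatisfiedBy C τ) ↔
      (∀ C ∈ derFormula G t, Clause.SatisfiedBy C (fun x => τ (.der x))) ∧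
      (∀ v i, ∃ a, τ (.l v a i) = true) ∧
      (∀ v a b i, a < b → ¬ (τ (.l v a i) = true ∧ τ (.l v b i) = true)) ∧
      (∀ u v a i, u < v →
        (τ (.l u a i) = true → τ (.l v a i) = true → τ (.der (.c u v i)) = true →
          τ (.der (.g u v i)) = true) ∧
        (τ (.der (.g u v i)) = true → (τ (.l u a i) = true ↔ τ (.l v a i) = true))) := by
  simp only [directFormula, Finset.mem_union, Set.Finite.mem_toFinset, Set.mem_union, or_imp,
    forall_and, rename_satisfied, and_assoc]
  refine and_congr Iff.rfl (and_congr ?_ (and_congr ?_ ?_))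
  · constructor
    · intro h v i
      have := h _ ⟨v, i, rfl⟩
      simpa [Clause.SatisfiedBy] using this
    · rintro h C ⟨v, i, rfl⟩
      simpa [Clause.SatisfiedBy] using h v i
  · constructor
    · intro h v a b i hab
      have := h _ ⟨v, a, b, i, hab, rfl⟩
      simp [Clause.SatisfiedBy] at this; grind
    · rintro h C ⟨v, a, b, i, hab, rfl⟩
      have := h v a b i hab
      simp [Clause.SatisfiedBy]; grind
  · constructor
    · intro h
      simp only [← forall_and]
      intro u v a i huv
      have h1 := h _ ⟨u, v, a, i, huv, Or.inl rfl⟩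
      have h2 := h _ ⟨u, v, a, i, huv, Or.inr (Or.inl rfl)⟩
      have h3 := h _ ⟨u, v, a, i, huv, Or.inr (Or.inr rfl)⟩
      simp [Clause.SatisfiedBy] at h1 h2 h3
      grind
    · rintro h C ⟨u, v, a, i, huv, rfl | rfl | rfl⟩ <;>
        have h1 := h.1 u v a i huv <;>
        have h2 := h.2 u v a i huv <;>
        simp [Clause.SatisfiedBy] <;> grind

/-- For fixed `i`, the clauses requiring at least and at most one number make `l_{v,a,i}` the graph
of a function `V → Fin k`; the remaining ones say that it separates exactly the groups inside each
component. -/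
theorem directFormula_satisfiable_iff {V : Type*} [Finite V] [Nonempty V] [LinearOrder V]
    (G : SimpleGraph V) (k t : ℕ) :
    CNF.Satisfiable (directFormula G k t) ↔
      ∃ T : Fin (t + 1) → Template V, IsDerivationOf T G ∧ ∀ i, (T i).HasLabels k := by
  constructor
  · rintro ⟨τ, hτ⟩
    obtain ⟨h1, h2, h3, h4⟩ := directFormula_satisfied.1 hτ
    obtain ⟨T, hT⟩ := exists_encodes_of_satisfied h1
    have hD := (satisfied_iff_of_encodes hT).1 h1
    refine ⟨T, hD, fun i => ?_⟩
    choose l hl using fun v => h2 v i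
    have hl' : ∀ v a, τ (.l v a i) = true ↔ l v = a := by
      refine fun v a => ⟨fun h => ?_, fun h => h ▸ hl v⟩
      rcases lt_trichotomy (l v) a with h' | h' | h'
      · exact (h3 v _ _ i h' ⟨hl v, h⟩).elim
      · exact h'
      · exact (h3 v _ _ i h' ⟨h, hl v⟩).elim
    have key : ∀ u v, u < v → (T i).cmp u v → (l u = l v ↔ (T i).grp u v) := by
      intro u v huv hc
      refine ⟨fun h => ?_, fun h => ?_⟩
      · exact (hT.grp u v i huv).1 ((h4 u v (l u) i huv).1 (hl u) ((hl' v _).2 h.symm)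
          ((hT.cmp u v i huv).2 hc))
      · exact ((hl' v _).1 (((h4 u v (l u) i huv).2 ((hT.grp u v i huv).2 h)).1 (hl u))).symm
    refine ⟨l, fun u v hc => ?_⟩
    rcases lt_trichotomy u v with h | rfl | h
    · exact key u v h hc
    · exact ⟨fun _ => Setoid.refl' _ u, fun _ => rfl⟩
    · rw [eq_comm, key v u h (Setoid.symm' _ hc)]
      exact Setoid.comm' _
  · rintro ⟨T, hD, hL⟩
    classical
    obtain ⟨τ, hτ⟩ := exists_encodes T
    choose l hl using hL
    refine ⟨fun x => match x with
      | .der y => τ y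
      | .l v a i => decide (l i v = a), directFormula_satisfied.2
        ⟨(satisfied_iff_of_encodes hτ).2 hD, ?_, ?_, ?_⟩⟩
    · exact fun v i => ⟨l i v, by simp⟩
    · intro v a b i hab
      simp only [decide_eq_true_eq]
      grind
    · intro u v a i huv
      simp only [decide_eq_true_eq]
      rw [hτ.cmp u v i huv, hτ.grp u v i huv]
      refine ⟨fun h1 h2 hc => (hl i u v hc).1 (h1.trans h2.symm), fun hg => ?_⟩
      rw [(hl i u v (hD.isDerivation.grp_le_cmp i hg)).2 hg]

end CliqueWidthSAT

/-! ### Simultaneous relabelings and edge insertions in `k`-expressions -/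

namespace CliqueWidthSAT

namespace KExpr

variable {k : ℕ} {V : Type*}

lemma mem_verts_of_adj {φ : KExpr k V} {u v : V} (h : φ.Adj u v) : u ∈ φ.verts ∧ v ∈ φ.verts := by
  induction φ with
  | init => exact h.elim
  | union φ ψ ih1 ih2 =>
    rcases h with h | h
    · exact ⟨Or.inl (ih1 h).1, Or.inl (ih1 h).2⟩
    · exact ⟨Or.inr (ih2 h).1, Or.inr (ih2 h).2⟩
  | relabel i j hij φ ih => exact ih h
  | addEdges i j hij φ ih =>
    rcases h with h | ⟨h1, h2, -⟩
    · exact ih h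
    · exact ⟨h1, h2⟩

/-- Rename the labels of a `k`-expression along an injection. -/
def mapLabels {m : ℕ} (f : Fin k ↪ Fin m) : KExpr k V → KExpr m V
  | init i v => init (f i) v
  | union φ ψ => union (φ.mapLabels f) (ψ.mapLabels f)
  | relabel i j hij φ => relabel (f i) (f j) (f.injective.ne hij) (φ.mapLabels f)
  | addEdges i j hij φ => addEdges (f i) (f j) (f.injective.ne hij) (φ.mapLabels f)

section mapLabels

variable {m : ℕ} (f : Fin k ↪ Fin m)

lemma verts_mapLabels (φ : KExpr k V) : (φ.mapLabels f).verts = φ.verts := by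
  induction φ <;> simp_all [mapLabels, verts]

lemma label_mapLabels (φ : KExpr k V) (u : V) : (φ.mapLabels f).label u = f (φ.label u) := by
  classical
  induction φ with
  | init => rfl
  | union φ ψ ih1 ih2 =>
    simp only [mapLabels, label, ih1, ih2, apply_ite f]
    rw [verts_mapLabels]
  | relabel i j hij φ ih => simp [mapLabels, label, ih, apply_ite f]
  | addEdges i j hij φ ih => exact ih

lemma adj_mapLabels (φ : KExpr k V) (u v : V) : (φ.mapLabels f).Adj u v ↔ φ.Adj u v := by
  induction φ <;> simp_all [mapLabels, Adj, verts_mapLabels, label_mapLabels]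

lemma wellFormed_mapLabels (φ : KExpr k V) : (φ.mapLabels f).WellFormed ↔ φ.WellFormed := by
  induction φ <;> simp_all [mapLabels, WellFormed, verts_mapLabels]

lemma Defines.mapLabels {φ : KExpr k V} {G : SimpleGraph V} (h : φ.Defines G) :
    (φ.mapLabels f).Defines G :=
  ⟨(wellFormed_mapLabels f φ).2 h.1, (verts_mapLabels f φ).trans h.2.1,
    fun u v => (adj_mapLabels f φ u v).trans (h.2.2 u v)⟩

end mapLabels

/-- Some well-formed `k`-expression constructs the graph with vertex set `S`, adjacency `A` and
labels `l`. -/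
def Constructs (k : ℕ) (S : Set V) (A : V → V → Prop) (l : V → Fin k) : Prop :=
  ∃ φ : KExpr k V, φ.WellFormed ∧ φ.verts = S ∧ (∀ u v, φ.Adj u v ↔ A u v) ∧
    ∀ u ∈ S, φ.label u = l u

/-- Single relabelings cannot permute labels, but renaming the labels throughout the expression can.
A map that is not injective is made more injective by one relabeling that merges two labels with the
same image, so the induction is on the number of values that `f` misses. -/
lemma Constructs.comp {S : Set V} {A : V → V → Prop} (f : Fin k → Fin k) {l : V → Fin k}
    (h : Constructs k S A l) : Constructs k S A (f ∘ l) := by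
  classical
  induction hn : k - (Finset.univ.image f).card using Nat.strong_induction_on generalizing f l with
  | _ n ih =>
    by_cases hf : Function.Injective f
    · obtain ⟨φ, h1, h2, h3, h4⟩ := h
      exact ⟨φ.mapLabels ⟨f, hf⟩, (wellFormed_mapLabels _ _).2 h1, (verts_mapLabels _ _).trans h2,
        fun u v => (adj_mapLabels _ _ _ _).trans (h3 u v),
        fun u hu => by simp [label_mapLabels, h4 u hu]⟩
    · have hs : ¬ Function.Surjective f := fun hs => hf (Finite.injective_iff_surjective.2 hs)
      obtain ⟨c, hc⟩ := not_forall.1 hs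
      obtain ⟨a, b, hab, hne⟩ : ∃ a b, f a = f b ∧ a ≠ b := by
        simpa [Function.Injective] using hf
      -- After relabeling `a` to `b` the label `a` is unused, so `f a` may be changed to the missed
      -- value `c`.
      let l' : V → Fin k := fun u => if l u = a then b else l u
      have hl' : Constructs k S A l' := by
        obtain ⟨φ, h1, h2, h3, h4⟩ := h
        refine ⟨.relabel a b hne φ, h1, h2, h3, fun u hu => ?_⟩
        simp only [label, h4 u hu, l']
      have hcomp : f ∘ l = Function.update f a c ∘ l' := by
        funext u
        by_cases hu : l u = a
        · simp [l', hu, Function.update_of_ne hne.symm, hab]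
        · simp [l', hu]
      rw [hcomp]
      -- The value `f a` is still taken at `b`, and `c` is new.
      have hlt : (Finset.univ.image f).card < (Finset.univ.image (Function.update f a c)).card := by
        apply Finset.card_lt_card
        refine Finset.ssubset_iff_subset_ne.2 ⟨?_, ?_⟩
        · intro y hy
          obtain ⟨x, -, rfl⟩ := Finset.mem_image.1 hy
          by_cases hx : x = a
          · exact Finset.mem_image.2 ⟨b, Finset.mem_univ _, by
              rw [Function.update_of_ne hne.symm, hx, hab]⟩
          · exact Finset.mem_image.2 ⟨x, Finset.mem_univ _, by rw [Function.update_of_ne hx]⟩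
        · intro he
          have : c ∈ Finset.univ.image f := by
            rw [he]
            exact Finset.mem_image.2 ⟨a, Finset.mem_univ _, by simp⟩
          obtain ⟨x, -, hx⟩ := Finset.mem_image.1 this
          exact hc ⟨x, hx⟩
      have hle := Finset.card_le_univ (Finset.univ.image (Function.update f a c))
      rw [Fintype.card_fin] at hle
      exact ih _ (by omega) _ hl' rfl

lemma Constructs.congr {S S' : Set V} {A A' : V → V → Prop} {l l' : V → Fin k}
    (h : Constructs k S A l) (hS : S = S') (hA : ∀ u v, A u v ↔ A' u v)
    (hl : ∀ u ∈ S, l u = l' u) : Constructs k S' A' l' := by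
  subst hS
  obtain ⟨φ, h1, h2, h3, h4⟩ := h
  exact ⟨φ, h1, h2, fun u v => (h3 u v).trans (hA u v), fun u hu => (h4 u hu).trans (hl u hu)⟩

lemma Constructs.relabel_of_factors {S : Set V} {A : V → V → Prop} {l l' : V → Fin k}
    (h : Constructs k S A l) (hl : ∀ u ∈ S, ∀ v ∈ S, l u = l v → l' u = l' v) :
    Constructs k S A l' := by
  classical
  -- On labels that do not occur in `S` the value is irrelevant.
  refine (h.comp fun a => if ha : ∃ u ∈ S, l u = a then l' ha.choose else a).congr rfl
    (fun _ _ => Iff.rfl) fun u hu => ?_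
  have ha : ∃ v ∈ S, l v = l u := ⟨u, hu, rfl⟩
  simp only [Function.comp, dif_pos ha]
  exact hl _ ha.choose_spec.1 _ hu ha.choose_spec.2

lemma Constructs.union {S S' : Set V} {A A' : V → V → Prop} {l : V → Fin k}
    (h : Constructs k S A l) (h' : Constructs k S' A' l) (hd : Disjoint S S') :
    Constructs k (S ∪ S') (fun u v => A u v ∨ A' u v) l := by
  classical
  obtain ⟨φ, h1, rfl, h3, h4⟩ := h
  obtain ⟨ψ, h1', rfl, h3', h4'⟩ := h'
  refine ⟨.union φ ψ, ⟨h1, h1', hd⟩, rfl, fun u v => or_congr (h3 u v) (h3' u v), fun u hu => ?_⟩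
  simp only [label]
  split_ifs with hφ
  · exact h4 u hφ
  · exact h4' u (hu.resolve_left hφ)

/-- Edge insertions change no label, so the pairs in `P` can be treated one after the other. -/
lemma Constructs.addEdges {S : Set V} {A : V → V → Prop} {l : V → Fin k}
    (h : Constructs k S A l) (P : Finset (Fin k × Fin k)) (hP : ∀ p ∈ P, p.1 ≠ p.2) :
    Constructs k S (fun u v => A u v ∨ (u ∈ S ∧ v ∈ S ∧ ((l u, l v) ∈ P ∨ (l v, l u) ∈ P))) l := by
  classical
  induction P using Finset.induction_on with
  | empty => exact h.congr rfl (fun u v => by simp) fun _ _ => rfl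
  | insert p P _ ih =>
    obtain ⟨φ, h1, h2, h3, h4⟩ := ih fun q hq => hP q (Finset.mem_insert_of_mem hq)
    refine ⟨.addEdges p.1 p.2 (hP p (Finset.mem_insert_self _ _)) φ, h1, h2, fun u v => ?_, h4⟩
    simp only [Adj, h3, h2]
    by_cases hu : u ∈ S <;> by_cases hv : v ∈ S <;> 
      simp only [hu, hv, true_and, false_and, or_false, and_false]
    rw [h4 u hu, h4 v hv]
    obtain ⟨a, b⟩ := p
    simp only [Finset.mem_insert, Prod.mk.injEq]
    tauto

end KExpr

open KExpr

/-! ### From derivations to `k`-expressions -/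

section ToExpression

variable {V : Type*} {G : SimpleGraph V} {k : ℕ}

/-- The conditions on two consecutive templates of a derivation of `G`. -/
structure Step (G : SimpleGraph V) (T T' : Template V) : Prop where
  cmp_le : T.cmp ≤ T'.cmp
  grp_le : T.grp ≤ T'.grp
  edge : ∀ u v : V, G.Adj u v → T'.grp u v → T.cmp u v
  neighborhood : ∀ u v w : V, u ≠ w → G.Adj u v → ¬ G.Adj u w → T'.grp v w → T.cmp u v
  path : ∀ u v w x : V, w ≠ x → G.Adj u v → G.Adj u w → G.Adj v x → ¬ G.Adj w x →
    T'.grp u x → T'.grp v w → T.cmp u v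

lemma IsDerivationOf.step {t : ℕ} {T : Fin (t + 1) → Template V} (h : IsDerivationOf T G)
    (i : Fin t) : Step G (T i.castSucc) (T i.succ) :=
  ⟨h.isDerivation.cmp_mono i, h.isDerivation.grp_mono i, h.edge_property i,
    h.neighborhood_property i, h.path_property i⟩

/-- Every component of `T` induces a subgraph that has a `k`-expression, with any labels that are
constant on groups. -/
def Template.Expressible (G : SimpleGraph V) (k : ℕ) (T : Template V) : Prop :=
  ∀ r : V, ∀ l : V → Fin k, (∀ u v, T.grp u v → l u = l v) →
    Constructs k {v | T.cmp r v} (fun u v => T.cmp r u ∧ T.cmp r v ∧ G.Adj u v) l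

lemma expressible_of_cmp_eq_bot {T : Template V} (h : T.cmp = ⊥) : T.Expressible G k := by
  intro r l _
  have hc : ∀ u v, T.cmp u v ↔ u = v := fun u v => by rw [h]; exact Iff.rfl
  refine ⟨.init (l r) r, trivial, ?_, fun u v => ?_, ?_⟩
  · ext v
    simp only [verts, hc, Set.mem_singleton_iff, Set.mem_ofPred_eq]
    exact eq_comm
  · simp only [Adj, hc, false_iff]
    rintro ⟨rfl, rfl, h3⟩
    exact G.loopless.irrefl _ h3
  · intro u hu
    simp only [hc, Set.mem_ofPred_eq] at hu
    cases hu
    rfl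

lemma Template.Expressible.constructs_iUnion [Finite V] {T : Template V}
    (hT : T.Expressible G k) (l : V → Fin k) (hl : ∀ u v, T.grp u v → l u = l v)
    (s : Finset (Quotient T.cmp)) (hs : s.Nonempty) :
    Constructs k {v | Quotient.mk T.cmp v ∈ s}
      (fun u v => Quotient.mk T.cmp u ∈ s ∧ T.cmp u v ∧ G.Adj u v) l := by
  have single : ∀ q : Quotient T.cmp, Constructs k {v | Quotient.mk T.cmp v = q}
      (fun u v => Quotient.mk T.cmp u = q ∧ T.cmp u v ∧ G.Adj u v) l := by
    intro q
    induction q using Quotient.inductionOn with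
    | _ r =>
      have key : ∀ v, Quotient.mk T.cmp v = Quotient.mk T.cmp r ↔ T.cmp r v := fun v =>
        Quotient.eq.trans (Setoid.comm' _)
      refine (hT r l hl).congr ?_ ?_ fun _ _ => rfl
      · ext v
        exact (key v).symm
      · intro u v
        rw [key]
        exact ⟨fun ⟨h1, h2, h3⟩ => ⟨h1, Setoid.trans' _ (Setoid.symm' _ h1) h2, h3⟩,
          fun ⟨h1, h2, h3⟩ => ⟨h1, Setoid.trans' _ h1 h2, h3⟩⟩
  induction hs using Finset.Nonempty.cons_induction with
  | singleton q => simpa using single q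
  | cons q s hq hs ih =>
    refine ((single q).union ih ?_).congr ?_ ?_ fun _ _ => rfl
    · rw [Set.disjoint_left]
      rintro v rfl hv
      exact hq hv
    · ext v
      simp
    · intro u v
      simp only [Finset.mem_cons]
      tauto

/-- The old components inside a new one are constructed with the labels `l` of the new template;
this is why `Template.Expressible` allows every labeling constant on groups. After their union and
the insertion of the missing edges, any labeling constant on the new groups factors through `l`. -/
lemma Template.Expressible.step [Finite V] {T T' : Template V} (hT : T.Expressible G k)
    (h : Step G T T') (hg : T'.grp ≤ T'.cmp) (hL : T'.HasLabels k) : T'.Expressible G k := by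
  classical
  have := Fintype.ofFinite (Quotient T.cmp)
  obtain ⟨l, hl⟩ := hL
  have hlg : ∀ u v, T'.grp u v → l u = l v := fun u v huv => (hl u v (hg huv)).2 huv
  intro r l' hl'
  let s : Finset (Quotient T.cmp) :=
    Finset.univ.filter fun q => ∃ v, T'.cmp r v ∧ Quotient.mk T.cmp v = q
  have hs : ∀ v, Quotient.mk T.cmp v ∈ s ↔ T'.cmp r v := by
    intro v
    simp only [s, Finset.mem_filter, Finset.mem_univ, true_and]
    refine ⟨?_, fun hv => ⟨v, hv, rfl⟩⟩
    rintro ⟨w, hw, hwv⟩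
    exact Setoid.trans' _ hw (h.cmp_le (Quotient.exact hwv))
  have hne : s.Nonempty := ⟨Quotient.mk _ r, (hs r).2 (Setoid.refl' _ r)⟩
  -- The label pairs of the edges of `G` that join different old components.
  let P : Finset (Fin k × Fin k) := Finset.univ.filter fun p =>
    ∃ u v, T'.cmp r u ∧ T'.cmp r v ∧ G.Adj u v ∧ ¬ T.cmp u v ∧ l u = p.1 ∧ l v = p.2
  have same : ∀ u v, T'.cmp r u → T'.cmp r v → l u = l v → T'.grp u v := fun u v hu hv he =>
    (hl u v (Setoid.trans' _ (Setoid.symm' _ hu) hv)).1 he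
  have hP : ∀ p ∈ P, p.1 ≠ p.2 := by
    rintro ⟨a, b⟩ hp hab
    obtain ⟨u, v, hu, hv, huv, hc, h1, h2⟩ := (Finset.mem_filter.1 hp).2
    exact hc (h.edge u v huv (same u v hu hv (h1.trans (hab.trans h2.symm))))
  -- An edge `uv` across old components with `u'` in the group of `u` and `v'` in that of `v` forces
  -- the edges `uv'` and `vu'` by the neighborhood property, and then `u'v'` by the path property.
  -- The labels differ by `hP`, which gives the required distinctness.
  have full : ∀ u v, T'.cmp r u → T'.cmp r v → (l u, l v) ∈ P → G.Adj u v := by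
    intro u' v' hu' hv' hp
    have hne' := hP _ hp
    obtain ⟨u, v, hu, hv, huv, hc, h1, h2⟩ := (Finset.mem_filter.1 hp).2
    have hc' : ¬ T.cmp v u := fun hh => hc (Setoid.symm' _ hh)
    have hgu : T'.grp u u' := same u u' hu hu' h1
    have hgv : T'.grp v v' := same v v' hv hv' h2
    have e1 : G.Adj u v' := by
      by_contra hcon
      refine hc (h.neighborhood u v v' ?_ huv hcon hgv)
      rintro rfl
      exact hne' h1.symm
    have e2 : G.Adj v u' := by
      by_contra hcon
      refine hc' (h.neighborhood v u u' ?_ huv.symm hcon hgu)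
      rintro rfl
      exact hne' h2
    by_contra hcon
    refine hc (h.path u v v' u' ?_ huv e1 e2 (fun hh => hcon hh.symm) hgu hgv)
    rintro rfl
    exact hne' rfl
  have hbase := hT.constructs_iUnion l (fun u v huv => hlg u v (h.grp_le huv)) s hne
  refine ((hbase.addEdges P hP).congr (A' := fun u v => T'.cmp r u ∧ T'.cmp r v ∧ G.Adj u v)
    (S' := {v | T'.cmp r v}) (l' := l) ?_ ?_ fun _ _ => rfl).relabel_of_factors ?_
  · ext v
    exact hs v
  · intro u v
    simp only [hs, Set.mem_ofPred_eq]
    constructor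
    · rintro (⟨h1, h2, h3⟩ | ⟨h1, h2, h3 | h3⟩)
      · exact ⟨h1, Setoid.trans' _ h1 (h.cmp_le h2), h3⟩
      · exact ⟨h1, h2, full u v h1 h2 h3⟩
      · exact ⟨h1, h2, (full v u h2 h1 h3).symm⟩
    · rintro ⟨h1, h2, h3⟩
      by_cases hc : T.cmp u v
      · exact Or.inl ⟨h1, hc, h3⟩
      · refine Or.inr ⟨h1, h2, Or.inl ?_⟩
        exact Finset.mem_filter.2 ⟨Finset.mem_univ _, u, v, h1, h2, h3, hc, rfl, rfl⟩
  · exact fun u hu v hv he => hl' u v (same u v hu hv he)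

lemma exists_defines_of_derivation [Finite V] [Nonempty V] {t : ℕ}
    {T : Fin (t + 1) → Template V} (hD : IsDerivationOf T G) (hL : ∀ i, (T i).HasLabels k) :
    ∃ φ : KExpr k V, φ.Defines G := by
  have hE : ∀ i, (T i).Expressible G k := by
    intro i
    induction i using Fin.induction with
    | zero =>
      exact expressible_of_cmp_eq_bot
        ((ncard_classes_eq_card_iff _).1 hD.isDerivation.card_cmp_first)
    | succ i ih => exact ih.step (hD.step i) (hD.isDerivation.grp_le_cmp _) (hL _)
  have htop := (ncard_classes_eq_one_iff _).1 hD.isDerivation.card_cmp_last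
  obtain ⟨l, hl⟩ := hL (Fin.last t)
  obtain ⟨r⟩ := ‹Nonempty V›
  obtain ⟨φ, h1, h2, h3, -⟩ := hE (Fin.last t) r l fun u v huv =>
    (hl u v (hD.isDerivation.grp_le_cmp _ huv)).2 huv
  have hall : ∀ v, (T (Fin.last t)).cmp r v := fun v => by rw [htop]; trivial
  refine ⟨φ, h1, h2.trans (Set.eq_univ_of_forall hall), fun u v => ?_⟩
  rw [h3]
  exact ⟨fun h => h.2.2, fun h => ⟨hall u, hall v, h⟩⟩

end ToExpression

end CliqueWidthSAT

/-! ### From `k`-expressions to sequences of templates -/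

namespace CliqueWidthSAT

namespace KExpr

variable {k : ℕ} {V : Type*}

/-- The largest number of unions on a branch of the term. -/
def height : KExpr k V → ℕ
  | init _ _ => 0
  | union φ ψ => max φ.height ψ.height + 1
  | relabel _ _ _ φ => φ.height
  | addEdges _ _ _ φ => φ.height

/-- `u` and `v` are both constructed by one subterm of height at most `i`. -/
def CmpAt : KExpr k V → ℕ → V → V → Prop
  | init _ a, _, u, v => u = a ∧ v = a
  | union φ ψ, i, u, v => (max φ.height ψ.height + 1 ≤ i ∧ u ∈ (φ.union ψ).verts ∧
      v ∈ (φ.union ψ).verts) ∨ φ.CmpAt i u v ∨ ψ.CmpAt i u v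
  | relabel _ _ _ φ, i, u, v => φ.CmpAt i u v
  | addEdges _ _ _ φ, i, u, v => φ.CmpAt i u v

/-- `u` and `v` have the same label in the graph constructed by one vertex or one union of height
at most `i`. -/
def GrpAt : KExpr k V → ℕ → V → V → Prop
  | init _ a, _, u, v => u = a ∧ v = a
  | union φ ψ, i, u, v => (max φ.height ψ.height + 1 ≤ i ∧ u ∈ (φ.union ψ).verts ∧
      v ∈ (φ.union ψ).verts ∧ (φ.union ψ).label u = (φ.union ψ).label v) ∨
      φ.GrpAt i u v ∨ ψ.GrpAt i u v
  | relabel _ _ _ φ, i, u, v => φ.GrpAt i u v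
  | addEdges _ _ _ φ, i, u, v => φ.GrpAt i u v

lemma label_union_left {φ ψ : KExpr k V} {u : V} (hu : u ∈ φ.verts) :
    (φ.union ψ).label u = φ.label u := if_pos hu

lemma label_union_right {φ ψ : KExpr k V} (h : Disjoint φ.verts ψ.verts) {u : V}
    (hu : u ∈ ψ.verts) : (φ.union ψ).label u = ψ.label u :=
  if_neg fun h' => Set.disjoint_left.1 h h' hu

lemma CmpAt.mem {φ : KExpr k V} {i : ℕ} {u v : V} (h : φ.CmpAt i u v) :
    u ∈ φ.verts ∧ v ∈ φ.verts := by
  induction φ with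
  | init => exact h
  | union φ ψ ih1 ih2 =>
    rcases h with ⟨-, h⟩ | h | h
    · exact h
    · exact (ih1 h).imp Or.inl Or.inl
    · exact (ih2 h).imp Or.inr Or.inr
  | relabel i j hij φ ih => exact ih h
  | addEdges i j hij φ ih => exact ih h

lemma GrpAt.cmpAt {φ : KExpr k V} {i : ℕ} {u v : V} (h : φ.GrpAt i u v) : φ.CmpAt i u v := by
  induction φ with
  | init => exact h
  | union φ ψ ih1 ih2 =>
    rcases h with ⟨h1, h2, h3, -⟩ | h | h
    · exact Or.inl ⟨h1, h2, h3⟩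
    · exact Or.inr (Or.inl (ih1 h))
    · exact Or.inr (Or.inr (ih2 h))
  | relabel i j hij φ ih => exact ih h
  | addEdges i j hij φ ih => exact ih h

lemma GrpAt.label_eq {φ : KExpr k V} (hφ : φ.WellFormed) {i : ℕ} {u v : V}
    (h : φ.GrpAt i u v) : φ.label u = φ.label v := by
  induction φ with
  | init => rfl
  | union φ ψ ih1 ih2 =>
    rcases h with ⟨-, -, -, h⟩ | h | h
    · exact h
    · rw [label_union_left h.cmpAt.mem.1, label_union_left h.cmpAt.mem.2, ih1 hφ.1 h]
    · rw [label_union_right hφ.2.2 h.cmpAt.mem.1, label_union_right hφ.2.2 h.cmpAt.mem.2,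
        ih2 hφ.2.1 h]
  | relabel i j hij φ ih => simp only [label, ih hφ h]
  | addEdges i j hij φ ih => exact ih hφ h

lemma CmpAt.mono {φ : KExpr k V} {i j : ℕ} (hij : i ≤ j) {u v : V} (h : φ.CmpAt i u v) :
    φ.CmpAt j u v := by
  induction φ with
  | init => exact h
  | union φ ψ ih1 ih2 => exact h.imp (fun h => ⟨h.1.trans hij, h.2⟩) (Or.imp ih1 ih2)
  | relabel i j hij φ ih => exact ih h
  | addEdges i j hij φ ih => exact ih h

lemma GrpAt.mono {φ : KExpr k V} {i j : ℕ} (hij : i ≤ j) {u v : V} (h : φ.GrpAt i u v) :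
    φ.GrpAt j u v := by
  induction φ with
  | init => exact h
  | union φ ψ ih1 ih2 => exact h.imp (fun h => ⟨h.1.trans hij, h.2⟩) (Or.imp ih1 ih2)
  | relabel i j hij φ ih => exact ih h
  | addEdges i j hij φ ih => exact ih h

lemma CmpAt.symm {φ : KExpr k V} {i : ℕ} {u v : V} (h : φ.CmpAt i u v) : φ.CmpAt i v u := by
  induction φ with
  | init => exact And.symm h
  | union φ ψ ih1 ih2 => exact h.imp (fun h => ⟨h.1, h.2.2, h.2.1⟩) (Or.imp ih1 ih2)
  | relabel i j hij φ ih => exact ih h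
  | addEdges i j hij φ ih => exact ih h

lemma GrpAt.symm {φ : KExpr k V} {i : ℕ} {u v : V} (h : φ.GrpAt i u v) : φ.GrpAt i v u := by
  induction φ with
  | init => exact And.symm h
  | union φ ψ ih1 ih2 =>
    exact h.imp (fun h => ⟨h.1, h.2.2.1, h.2.1, h.2.2.2.symm⟩) (Or.imp ih1 ih2)
  | relabel i j hij φ ih => exact ih h
  | addEdges i j hij φ ih => exact ih h

lemma GrpAt.refl {φ : KExpr k V} (i : ℕ) {u : V} (h : u ∈ φ.verts) : φ.GrpAt i u u := by
  induction φ with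
  | init => exact ⟨h, h⟩
  | union φ ψ ih1 ih2 => exact Or.inr (h.imp ih1 ih2)
  | relabel i j hij φ ih => exact ih h
  | addEdges i j hij φ ih => exact ih h

lemma CmpAt.trans {φ : KExpr k V} (hφ : φ.WellFormed) {i : ℕ} {u v w : V}
    (h : φ.CmpAt i u v) (h' : φ.CmpAt i v w) : φ.CmpAt i u w := by
  induction φ with
  | init => exact ⟨h.1, h'.2⟩
  | union φ ψ ih1 ih2 =>
    by_cases hi : max φ.height ψ.height + 1 ≤ i
    · exact Or.inl ⟨hi, h.mem.1, h'.mem.2⟩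
    · rcases h with ⟨h0, -⟩ | h | h
      · exact (hi h0).elim
      · rcases h' with ⟨h0, -⟩ | h' | h'
        · exact (hi h0).elim
        · exact Or.inr (Or.inl (ih1 hφ.1 h h'))
        · exact (Set.disjoint_left.1 hφ.2.2 h.mem.2 h'.mem.1).elim
      · rcases h' with ⟨h0, -⟩ | h' | h'
        · exact (hi h0).elim
        · exact (Set.disjoint_left.1 hφ.2.2 h'.mem.1 h.mem.2).elim
        · exact Or.inr (Or.inr (ih2 hφ.2.1 h h'))
  | relabel i j hij φ ih => exact ih hφ h h'
  | addEdges i j hij φ ih => exact ih hφ h h'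

lemma GrpAt.trans {φ : KExpr k V} (hφ : φ.WellFormed) {i : ℕ} {u v w : V}
    (h : φ.GrpAt i u v) (h' : φ.GrpAt i v w) : φ.GrpAt i u w := by
  induction φ with
  | init => exact ⟨h.1, h'.2⟩
  | union φ ψ ih1 ih2 =>
    by_cases hi : max φ.height ψ.height + 1 ≤ i
    · exact Or.inl ⟨hi, h.cmpAt.mem.1, h'.cmpAt.mem.2, (h.label_eq hφ).trans (h'.label_eq hφ)⟩
    · rcases h with ⟨h0, -⟩ | h | h
      · exact (hi h0).elim
      · rcases h' with ⟨h0, -⟩ | h' | h'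
        · exact (hi h0).elim
        · exact Or.inr (Or.inl (ih1 hφ.1 h h'))
        · exact (Set.disjoint_left.1 hφ.2.2 h.cmpAt.mem.2 h'.cmpAt.mem.1).elim
      · rcases h' with ⟨h0, -⟩ | h' | h'
        · exact (hi h0).elim
        · exact (Set.disjoint_left.1 hφ.2.2 h'.cmpAt.mem.1 h.cmpAt.mem.2).elim
        · exact Or.inr (Or.inr (ih2 hφ.2.1 h h'))
  | relabel i j hij φ ih => exact ih hφ h h'
  | addEdges i j hij φ ih => exact ih hφ h h'

lemma CmpAt.eq_of_zero {φ : KExpr k V} {u v : V} (h : φ.CmpAt 0 u v) : u = v := by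
  induction φ with
  | init => exact h.1.trans h.2.symm
  | union φ ψ ih1 ih2 =>
    rcases h with ⟨h, -⟩ | h | h
    · omega
    · exact ih1 h
    · exact ih2 h
  | relabel i j hij φ ih => exact ih h
  | addEdges i j hij φ ih => exact ih h

lemma CmpAt.of_height_le {φ : KExpr k V} {i : ℕ} (hi : φ.height ≤ i) {u v : V}
    (hu : u ∈ φ.verts) (hv : v ∈ φ.verts) : φ.CmpAt i u v := by
  induction φ with
  | init => exact ⟨hu, hv⟩
  | union φ ψ ih1 ih2 => exact Or.inl ⟨hi, hu, hv⟩
  | relabel i j hij φ ih => exact ih hi hu hv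
  | addEdges i j hij φ ih => exact ih hi hu hv

/-- The numbers are the labels just after the topmost union of height at most `i`; lower down,
disjointness lets the choices for the two operands be combined. -/
lemma exists_labels (φ : KExpr k V) (hφ : φ.WellFormed) (i : ℕ) :
    ∃ l : V → Fin k, ∀ u v, φ.CmpAt i u v → (l u = l v ↔ φ.GrpAt i u v) := by
  classical
  induction φ with
  | init a w =>
    exact ⟨fun _ => a, fun u v h => ⟨fun _ => h, fun _ => rfl⟩⟩
  | union φ ψ ih1 ih2 =>
    by_cases hi : max φ.height ψ.height + 1 ≤ i
    · exact ⟨(φ.union ψ).label, fun u v h =>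
        ⟨fun he => Or.inl ⟨hi, h.mem.1, h.mem.2, he⟩, fun hg => hg.label_eq hφ⟩⟩
    · obtain ⟨l1, h1⟩ := ih1 hφ.1
      obtain ⟨l2, h2⟩ := ih2 hφ.2.1
      refine ⟨fun u => if u ∈ φ.verts then l1 u else l2 u, ?_⟩
      rintro u v (⟨h0, -⟩ | h | h)
      · exact (hi h0).elim
      · simp only [if_pos h.mem.1, if_pos h.mem.2, h1 u v h]
        refine ⟨fun hg => Or.inr (Or.inl hg), ?_⟩
        rintro (⟨h0, -⟩ | hg | hg)
        · exact (hi h0).elim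
        · exact hg
        · exact (Set.disjoint_left.1 hφ.2.2 h.mem.1 hg.cmpAt.mem.1).elim
      · have hu : u ∉ φ.verts := fun hu => Set.disjoint_left.1 hφ.2.2 hu h.mem.1
        have hv : v ∉ φ.verts := fun hv => Set.disjoint_left.1 hφ.2.2 hv h.mem.2
        simp only [if_neg hu, if_neg hv, h2 u v h]
        refine ⟨fun hg => Or.inr (Or.inr hg), ?_⟩
        rintro (⟨h0, -⟩ | hg | hg)
        · exact (hi h0).elim
        · exact (hu hg.cmpAt.mem.1).elim
        · exact hg
  | relabel i j hij φ ih => exact ih hφ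
  | addEdges i j hij φ ih => exact ih hφ

/-- What holds between the graph `G` and every subterm `φ` of an expression that defines `G`. -/
structure Fits (φ : KExpr k V) (G : SimpleGraph V) : Prop where
  adj_le : ∀ u v, φ.Adj u v → G.Adj u v
  edge : ∀ u v, u ∈ φ.verts → v ∈ φ.verts → φ.label u = φ.label v → G.Adj u v → φ.Adj u v
  neighborhood : ∀ u v w, v ∈ φ.verts → w ∈ φ.verts → φ.label v = φ.label w → u ≠ w →
    G.Adj u v → ¬ G.Adj u w → φ.Adj u v
  path : ∀ u v w x, u ∈ φ.verts → x ∈ φ.verts → φ.label u = φ.label x → v ∈ φ.verts →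
    w ∈ φ.verts → φ.label v = φ.label w → w ≠ x → G.Adj u v → G.Adj u w → G.Adj v x →
    ¬ G.Adj w x → φ.Adj u v

variable {G : SimpleGraph V}

lemma Defines.fits {φ : KExpr k V} (h : φ.Defines G) : φ.Fits G :=
  ⟨fun u v => (h.2.2 u v).1, fun u v _ _ _ => (h.2.2 u v).2,
    fun u v _ _ _ _ _ hG _ => (h.2.2 u v).2 hG,
    fun u v _ _ _ _ _ _ _ _ _ hG _ _ _ => (h.2.2 u v).2 hG⟩

lemma Adj.of_union_left {φ ψ : KExpr k V} (hd : Disjoint φ.verts ψ.verts) {u v : V}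
    (h : (φ.union ψ).Adj u v) (hv : v ∈ φ.verts) : φ.Adj u v :=
  h.resolve_right fun h' => Set.disjoint_left.1 hd hv (mem_verts_of_adj h').2

lemma Adj.of_union_right {φ ψ : KExpr k V} (hd : Disjoint φ.verts ψ.verts) {u v : V}
    (h : (φ.union ψ).Adj u v) (hv : v ∈ ψ.verts) : ψ.Adj u v :=
  h.resolve_left fun h' => Set.disjoint_left.1 hd (mem_verts_of_adj h').2 hv

lemma Fits.union_left {φ ψ : KExpr k V} (hd : Disjoint φ.verts ψ.verts)
    (h : (φ.union ψ).Fits G) : φ.Fits G where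
  adj_le u v ha := h.adj_le u v (Or.inl ha)
  edge u v hu hv hl hG := (h.edge u v (Or.inl hu) (Or.inl hv)
    (by rwa [label_union_left hu, label_union_left hv]) hG).of_union_left hd hv
  neighborhood u v w hv hw hl huw hG hG' := (h.neighborhood u v w (Or.inl hv) (Or.inl hw)
    (by rwa [label_union_left hv, label_union_left hw]) huw hG hG').of_union_left hd hv
  path u v w x hu hx hl hv hw hl' hwx h1 h2 h3 h4 := (h.path u v w x (Or.inl hu) (Or.inl hx)
    (by rwa [label_union_left hu, label_union_left hx]) (Or.inl hv) (Or.inl hw)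
    (by rwa [label_union_left hv, label_union_left hw]) hwx h1 h2 h3 h4).of_union_left hd hv

lemma Fits.union_right {φ ψ : KExpr k V} (hd : Disjoint φ.verts ψ.verts)
    (h : (φ.union ψ).Fits G) : ψ.Fits G where
  adj_le u v ha := h.adj_le u v (Or.inr ha)
  edge u v hu hv hl hG := (h.edge u v (Or.inr hu) (Or.inr hv)
    (by rwa [label_union_right hd hu, label_union_right hd hv]) hG).of_union_right hd hv
  neighborhood u v w hv hw hl huw hG hG' := (h.neighborhood u v w (Or.inr hv) (Or.inr hw)
    (by rwa [label_union_right hd hv, label_union_right hd hw]) huw hG hG').of_union_right hd hv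
  path u v w x hu hx hl hv hw hl' hwx h1 h2 h3 h4 := (h.path u v w x (Or.inr hu) (Or.inr hx)
    (by rwa [label_union_right hd hu, label_union_right hd hx]) (Or.inr hv) (Or.inr hw)
    (by rwa [label_union_right hd hv, label_union_right hd hw])
    hwx h1 h2 h3 h4).of_union_right hd hv

lemma Fits.of_relabel {φ : KExpr k V} {i j : Fin k} {hij : i ≠ j}
    (h : (φ.relabel i j hij).Fits G) : φ.Fits G := by
  have hlab : ∀ {u v}, φ.label u = φ.label v →
      (φ.relabel i j hij).label u = (φ.relabel i j hij).label v := fun hl => by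
    simp only [label, hl]
  exact ⟨h.adj_le, fun u v hu hv hl => h.edge u v hu hv (hlab hl),
    fun u v w hv hw hl => h.neighborhood u v w hv hw (hlab hl),
    fun u v w x hu hx hl hv hw hl' => h.path u v w x hu hx (hlab hl) hv hw (hlab hl')⟩

/-- The insertion joins different labels, so it cannot supply an edge between equal ones. If it
supplied `uv`, it would also supply the non-edge `uw` in the neighborhood case and `wx` in the path
case. -/
lemma Fits.of_addEdges {φ : KExpr k V} {i j : Fin k} {hij : i ≠ j}
    (h : (φ.addEdges i j hij).Fits G) : φ.Fits G where
  adj_le u v ha := h.adj_le u v (Or.inl ha)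
  edge u v hu hv hl hG := by
    refine (h.edge u v hu hv hl hG).resolve_right ?_
    rintro ⟨-, -, ⟨h1, h2⟩ | ⟨h1, h2⟩⟩
    · exact hij (by rw [← h1, hl, h2])
    · exact hij (by rw [← h2, ← hl, h1])
  neighborhood u v w hv hw hl huw hG hG' := by
    refine (h.neighborhood u v w hv hw hl huw hG hG').resolve_right ?_
    rintro ⟨hu, -, h1⟩
    exact hG' (h.adj_le u w (Or.inr ⟨hu, hw, by rwa [← hl]⟩))
  path u v w x hu hx hl hv hw hl' hwx h1 h2 h3 h4 := by
    refine (h.path u v w x hu hx hl hv hw hl' hwx h1 h2 h3 h4).resolve_right ?_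
    rintro ⟨-, -, h0⟩
    exact h4 (h.adj_le w x (Or.inr ⟨hw, hx, by rw [← hl, ← hl']; tauto⟩))

/-- A union creates no edges, so the edge lies in one operand, whose height is at least one smaller.
-/
lemma cmpAt_of_adj_union {φ ψ : KExpr k V} {i : ℕ} (hi : max φ.height ψ.height + 1 ≤ i + 1)
    {u v : V} (h : (φ.union ψ).Adj u v) : (φ.union ψ).CmpAt i u v := by
  rcases h with h | h
  · exact Or.inr (Or.inl (CmpAt.of_height_le (by omega) (mem_verts_of_adj h).1
      (mem_verts_of_adj h).2))
  · exact Or.inr (Or.inr (CmpAt.of_height_le (by omega) (mem_verts_of_adj h).1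
      (mem_verts_of_adj h).2))

lemma Fits.cmpAt_of_edge {φ : KExpr k V} (hφ : φ.WellFormed) (hF : φ.Fits G) {i : ℕ} {u v : V}
    (hG : G.Adj u v) (h : φ.GrpAt (i + 1) u v) : φ.CmpAt i u v := by
  induction φ with
  | init => exact h
  | union φ ψ ih1 ih2 =>
    rcases h with ⟨hi, hu, hv, hl⟩ | h | h
    · exact cmpAt_of_adj_union hi (hF.edge u v hu hv hl hG)
    · exact Or.inr (Or.inl (ih1 hφ.1 (hF.union_left hφ.2.2) h))
    · exact Or.inr (Or.inr (ih2 hφ.2.1 (hF.union_right hφ.2.2) h))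
  | relabel i j hij φ ih => exact ih hφ hF.of_relabel h
  | addEdges i j hij φ ih => exact ih hφ hF.of_addEdges h

lemma Fits.cmpAt_of_neighborhood {φ : KExpr k V} (hφ : φ.WellFormed) (hF : φ.Fits G) {i : ℕ}
    {u v w : V} (huw : u ≠ w) (hG : G.Adj u v) (hG' : ¬ G.Adj u w)
    (h : φ.GrpAt (i + 1) v w) : φ.CmpAt i u v := by
  induction φ with
  | init => exact (hG' ((h.1.trans h.2.symm) ▸ hG)).elim
  | union φ ψ ih1 ih2 =>
    rcases h with ⟨hi, hv, hw, hl⟩ | h | h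
    · exact cmpAt_of_adj_union hi (hF.neighborhood u v w hv hw hl huw hG hG')
    · exact Or.inr (Or.inl (ih1 hφ.1 (hF.union_left hφ.2.2) h))
    · exact Or.inr (Or.inr (ih2 hφ.2.1 (hF.union_right hφ.2.2) h))
  | relabel i j hij φ ih => exact ih hφ hF.of_relabel h
  | addEdges i j hij φ ih => exact ih hφ hF.of_addEdges h

lemma Fits.cmpAt_of_path {φ : KExpr k V} (hφ : φ.WellFormed) (hF : φ.Fits G) {i : ℕ}
    {u v w x : V} (hwx : w ≠ x) (huv : G.Adj u v) (huw : G.Adj u w) (hvx : G.Adj v x)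
    (hwx' : ¬ G.Adj w x) (h : φ.GrpAt (i + 1) u x) (h' : φ.GrpAt (i + 1) v w) :
    φ.CmpAt i u v := by
  induction φ with
  | init => exact ⟨h.1, h'.1⟩
  | union φ ψ ih1 ih2 =>
    by_cases hi : max φ.height ψ.height + 1 ≤ i + 1
    · exact cmpAt_of_adj_union hi (hF.path u v w x h.cmpAt.mem.1 h.cmpAt.mem.2 (h.label_eq hφ)
        h'.cmpAt.mem.1 h'.cmpAt.mem.2 (h'.label_eq hφ) hwx huv huw hvx hwx')
    · rcases h with ⟨h0, -⟩ | h | h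
      · exact (hi h0).elim
      · rcases h' with ⟨h0, -⟩ | h' | h'
        · exact (hi h0).elim
        · exact Or.inr (Or.inl (ih1 hφ.1 (hF.union_left hφ.2.2) h h'))
        -- With `u`, `x` on one side and `v`, `w` on the other, a later insertion of `vx` would also
        -- insert the non-edge `wx`. So `vx` is already present in the operand containing `v`, which
        -- contradicts disjointness.
        · have := (hF.union_right hφ.2.2).neighborhood x v w h'.cmpAt.mem.1 h'.cmpAt.mem.2
            (h'.label_eq hφ.2.1) hwx.symm hvx.symm fun hh => hwx' hh.symm
          exact (Set.disjoint_left.1 hφ.2.2 h.cmpAt.mem.2 (mem_verts_of_adj this).1).elim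
      · rcases h' with ⟨h0, -⟩ | h' | h'
        · exact (hi h0).elim
        · have := (hF.union_left hφ.2.2).neighborhood x v w h'.cmpAt.mem.1 h'.cmpAt.mem.2
            (h'.label_eq hφ.1) hwx.symm hvx.symm fun hh => hwx' hh.symm
          exact (Set.disjoint_left.1 hφ.2.2 (mem_verts_of_adj this).1 h.cmpAt.mem.2).elim
        · exact Or.inr (Or.inr (ih2 hφ.2.1 (hF.union_right hφ.2.2) h h'))
  | relabel i j hij φ ih => exact ih hφ hF.of_relabel h h'
  | addEdges i j hij φ ih => exact ih hφ hF.of_addEdges h h'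

/-- The template whose components are the vertex sets of the maximal subterms of height at most
`i`. -/
def template (φ : KExpr k V) (hφ : φ.WellFormed) (huniv : φ.verts = Set.univ) (i : ℕ) :
    Template V where
  cmp :=
    { r := φ.CmpAt i
      iseqv := ⟨fun u => (GrpAt.refl i (huniv ▸ Set.mem_univ u)).cmpAt, CmpAt.symm,
        CmpAt.trans hφ⟩ }
  grp :=
    { r := φ.GrpAt i
      iseqv := ⟨fun u => GrpAt.refl i (huniv ▸ Set.mem_univ u), GrpAt.symm, GrpAt.trans hφ⟩ }

end KExpr

end CliqueWidthSAT

/-! ### Shortening derivations -/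

namespace CliqueWidthSAT

section Chains

variable {V : Type*} {G : SimpleGraph V} {k : ℕ}

/-- There are `m` steps of a derivation of `G` from `T` to a template with one component, where
all components have at most `k` groups. -/
def Reach (G : SimpleGraph V) (k : ℕ) : ℕ → Template V → Prop
  | 0, T => (T.grp ≤ T.cmp ∧ T.HasLabels k) ∧ T.cmp = ⊤
  | m + 1, T => (T.grp ≤ T.cmp ∧ T.HasLabels k) ∧ ∃ T', Step G T T' ∧ Reach G k m T'

/-- The last template can be repeated: with a single component, the conclusions of all three
properties hold. -/
lemma Reach.succ {m : ℕ} {T : Template V} (h : Reach G k m T) : Reach G k (m + 1) T := by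
  induction m generalizing T with
  | zero =>
    have htop : ∀ u v, T.cmp u v := fun u v => by rw [h.2]; trivial
    exact ⟨h.1, T, ⟨le_rfl, le_rfl, fun _ _ _ _ => htop _ _, fun _ _ _ _ _ _ _ => htop _ _,
      fun _ _ _ _ _ _ _ _ _ _ _ => htop _ _⟩, h⟩
  | succ m ih =>
    obtain ⟨h1, T', h2, h3⟩ := h
    exact ⟨h1, T', h2, ih h3⟩

lemma Reach.mono {m n : ℕ} (hmn : m ≤ n) {T : Template V} (h : Reach G k m T) :
    Reach G k n T := by
  induction hmn with
  | refl => exact h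
  | step _ ih => exact ih.succ

/-- The conditions on a step see the groups of the earlier template only through refinement, so a
step that merges no components can be skipped. -/
lemma Reach.of_cmp_eq {m : ℕ} {T T' : Template V} (h : Reach G k m T')
    (hT : T.grp ≤ T.cmp ∧ T.HasLabels k) (hc : T.cmp = T'.cmp) (hg : T.grp ≤ T'.grp) :
    Reach G k m T := by
  cases m with
  | zero => exact ⟨hT, hc.trans h.2⟩
  | succ m =>
    obtain ⟨-, T'', hs, hr⟩ := h
    refine ⟨hT, T'', ⟨?_, hg.trans hs.grp_le, ?_, ?_, ?_⟩, hr⟩ <;> rw [hc]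
    exacts [hs.cmp_le, hs.edge, hs.neighborhood, hs.path]

lemma Reach.exists_sequence {m : ℕ} {T : Template V} (h : Reach G k m T) :
    ∃ S : Fin (m + 1) → Template V, S 0 = T ∧ (S (Fin.last m)).cmp = ⊤ ∧
      (∀ i, (S i).grp ≤ (S i).cmp ∧ (S i).HasLabels k) ∧
      ∀ i : Fin m, Step G (S i.castSucc) (S i.succ) := by
  induction m generalizing T with
  | zero => exact ⟨fun _ => T, rfl, h.2, fun _ => h.1, fun i => i.elim0⟩
  | succ m ih =>
    obtain ⟨hT, T', hs, hr⟩ := h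
    obtain ⟨S, rfl, h1, h2, h3⟩ := ih hr
    refine ⟨Fin.cons T S, rfl, ?_, ?_, ?_⟩
    · rw [← Fin.succ_last, Fin.cons_succ]
      exact h1
    · intro i
      induction i using Fin.cases with
      | zero => exact hT
      | succ i => exact h2 i
    · intro i
      induction i using Fin.cases with
      | zero => exact hs
      | succ i =>
        rw [← Fin.succ_castSucc, Fin.cons_succ, Fin.cons_succ]
        exact h3 i

lemma card_quotient_lt [Finite V] {r s : Setoid V} (h : r < s) :
    Nat.card (Quotient s) < Nat.card (Quotient r) := by
  have hsurj : Function.Surjective (Quotient.map id (fun _ _ hab => h.le hab) :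
      Quotient r → Quotient s) := by
    intro q
    induction q using Quotient.inductionOn with
    | _ v => exact ⟨Quotient.mk r v, rfl⟩
  refine lt_of_le_of_ne (Nat.card_le_card_of_surjective _ hsurj) fun he => h.not_ge ?_
  have hbij := (Nat.bijective_iff_surjective_and_card _).2 ⟨hsurj, he.symm⟩
  intro u v huv
  exact Quotient.exact (hbij.1 (show Quotient.mk s u = Quotient.mk s v from Quotient.sound huv))

/-- The classes other than that of `r` are at most as many as the vertices outside it. -/
lemma card_quotient_add_le [Finite V] (s : Setoid V) (r : V) :
    Nat.card (Quotient s) + {v | s r v}.ncard ≤ Nat.card V + 1 := by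
  have h1 := Set.ncard_add_ncard_compl {v | s r v}
  have h2 := Set.ncard_add_ncard_compl {Quotient.mk s r}
  have h3 : ({Quotient.mk s r}ᶜ : Set (Quotient s)) ⊆ Quotient.mk s '' {v | s r v}ᶜ := by
    intro q hq
    induction q using Quotient.inductionOn with
    | _ v => exact ⟨v, fun hv => hq (Quotient.sound (s.symm' hv)), rfl⟩
  have h4 := (Set.ncard_le_ncard h3).trans (Set.ncard_image_le (Set.toFinite _))
  rw [Set.ncard_singleton] at h2
  omega

lemma hasLabels_of_ncard_le [Finite V] {s : Setoid V} (h : ∀ r, {v | s r v}.ncard ≤ k) :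
    Template.HasLabels k ⟨s, ⊥⟩ := by
  have hex : ∀ q : Quotient s, Nonempty ({v // Quotient.mk s v = q} ↪ Fin k) := by
    intro q
    induction q using Quotient.inductionOn with
    | _ r =>
      have hr : {v | s r v} = {v | Quotient.mk s v = Quotient.mk s r} := by
        ext v
        exact (Quotient.eq.trans (Setoid.comm' _)).symm
      have := h r
      rw [hr, ← Nat.card_coe_set_eq] at this
      obtain ⟨n, ⟨e⟩⟩ := Finite.exists_equiv_fin {v // Quotient.mk s v = Quotient.mk s r}
      have hn : n ≤ k := by
        rw [← Nat.card_fin n, ← Nat.card_congr e]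
        exact this
      exact ⟨e.toEmbedding.trans (Fin.castLEEmb hn)⟩
  let e := fun q => (hex q).some
  refine ⟨fun v => e (Quotient.mk s v) ⟨v, rfl⟩, fun u v huv => ?_⟩
  -- Both vertices have the same class, but only propositionally; `key` moves the comparison into
  -- one embedding `e q`.
  have key : ∀ q (hv : Quotient.mk s v = q) (hu : Quotient.mk s u = q),
      e (Quotient.mk s u) ⟨u, rfl⟩ = e (Quotient.mk s v) ⟨v, rfl⟩ ↔ e q ⟨u, hu⟩ = e q ⟨v, hv⟩ := by
    rintro q rfl hu
    have : ∀ p (hp : p = Quotient.mk s v) (hup : Quotient.mk s u = p),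
        e p ⟨u, hup⟩ = e (Quotient.mk s v) ⟨u, hu⟩ := by
      rintro p rfl hup
      rfl
    rw [this _ hu rfl]
  rw [key _ rfl (Quotient.sound huv), (e _).injective.eq_iff, Subtype.mk.injEq]
  exact Iff.rfl

/-- With singleton groups in the later template, the hypotheses of the three properties are
contradictory. -/
lemma Step.of_bot {T T' : Template V} (hc : T.cmp ≤ T'.cmp) (hg : T.grp = ⊥)
    (hg' : T'.grp = ⊥) : Step G T T' := by
  have h : ∀ u v, T'.grp u v → u = v := fun u v huv => by rw [hg'] at huv; exact huv
  refine ⟨hc, hg ▸ bot_le, ?_, ?_, ?_⟩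
  · intro u v hG huv
    exact (hG.ne (h _ _ huv)).elim
  · intro u v w _ hG hG' hvw
    exact (hG' (h _ _ hvw ▸ hG)).elim
  · intro u v w x _ _ hG hvx hG' hux hvw
    exact (hG' (h _ _ hvw ▸ hvx)).elim

lemma Step.of_cmp_eq {T T' T'' : Template V} (h : Step G T T'') (hc : T'.cmp = T.cmp)
    (hg : T'.grp ≤ T.grp) : Step G T' T'' := by
  refine ⟨?_, hg.trans h.grp_le, ?_, ?_, ?_⟩ <;> rw [hc]
  exacts [h.cmp_le, h.edge, h.neighborhood, h.path]

/-- Once the steps with unchanged components are skipped, each step lowers the number of components,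
which ends at one. -/
lemma reach_card_sub_one [Finite V] [Nonempty V] {f : ℕ → Template V} {N : ℕ}
    (hf : ∀ i, (f i).grp ≤ (f i).cmp ∧ (f i).HasLabels k) (hs : ∀ i, Step G (f i) (f (i + 1)))
    (hN : (f N).cmp = ⊤) {i : ℕ} (hi : i ≤ N) :
    Reach G k (Nat.card (Quotient (f i).cmp) - 1) (f i) := by
  induction hi using Nat.decreasingInduction with
  | self => exact Reach.mono (Nat.zero_le _) ⟨hf N, hN⟩
  | of_succ i _ ih =>
    rcases (hs i).cmp_le.eq_or_lt with heq | hlt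
    · rw [heq]
      exact ih.of_cmp_eq (hf i) heq (hs i).grp_le
    · have := card_quotient_lt hlt
      have hpos : 0 < Nat.card (Quotient (f (i + 1)).cmp) :=
        have : Nonempty (Quotient (f (i + 1)).cmp) := ‹Nonempty V›.map (Quotient.mk _)
        Nat.card_pos
      exact Reach.mono (m := Nat.card (Quotient (f (i + 1)).cmp) - 1 + 1) (by omega)
        ⟨hf i, f (i + 1), hs i, ih⟩

/-- One step leads from singletons to the components of `f i`, a second to `f (i + 1)`, and at most
`|V| - k - 1` more to the end. The first needs no intermediate levels because components with at
most `k` vertices can afford singleton groups. -/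
lemma reach_card_sub_add_one [Finite V] [Nonempty V] (hk : 1 ≤ k)
    {f : ℕ → Template V} {N : ℕ} (hf : ∀ i, (f i).grp ≤ (f i).cmp ∧ (f i).HasLabels k)
    (hs : ∀ i, Step G (f i) (f (i + 1))) (h0 : (f 0).cmp = ⊥) (hN : (f N).cmp = ⊤) :
    Reach G k (Nat.card V - k + 1) ⟨⊥, ⊥⟩ := by
  have hbot : ∀ r : V, {v | (⊥ : Setoid V) r v}.ncard ≤ k := by
    intro r
    have : {v | (⊥ : Setoid V) r v} = {r} := by
      ext v
      exact ⟨fun h => Eq.symm h, fun h => Eq.symm h⟩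
    rwa [this, Set.ncard_singleton]
  -- A level at which all components are still small, but which is either the final one or followed
  -- by a large component.
  obtain ⟨i, ⟨hiN, hi⟩, hi'⟩ : ∃ i, (i ≤ N ∧ ∀ r, {v | (f i).cmp r v}.ncard ≤ k) ∧
      ¬ (i + 1 ≤ N ∧ ∀ r, {v | (f (i + 1)).cmp r v}.ncard ≤ k) := by
    by_contra! hcon
    have : ∀ i, i ≤ N ∧ ∀ r, {v | (f i).cmp r v}.ncard ≤ k := by
      intro i
      induction i with
      | zero => exact ⟨Nat.zero_le _, by rw [h0]; exact hbot⟩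
      | succ i ih => exact hcon i ih
    exact absurd (this (N + 1)).1 (by omega)
  refine ⟨⟨le_rfl, hasLabels_of_ncard_le hbot⟩, ⟨(f i).cmp, ⊥⟩, Step.of_bot bot_le rfl rfl, ?_⟩
  have hlab := hasLabels_of_ncard_le hi
  rcases hiN.eq_or_lt with rfl | hlt
  · exact Reach.mono (Nat.zero_le _) ⟨⟨bot_le, hlab⟩, hN⟩
  · obtain ⟨r, hr⟩ : ∃ r, k < {v | (f (i + 1)).cmp r v}.ncard := by
      by_contra! hcon
      exact hi' ⟨hlt, hcon⟩
    have hcard := card_quotient_add_le (f (i + 1)).cmp r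
    have hpos : 0 < Nat.card (Quotient (f (i + 1)).cmp) :=
      have : Nonempty (Quotient (f (i + 1)).cmp) := ‹Nonempty V›.map (Quotient.mk _)
      Nat.card_pos
    -- By `hcard` and `hr`, the template `f (i + 1)` has at most `|V| - k` components.
    exact Reach.mono (m := Nat.card (Quotient (f (i + 1)).cmp) - 1 + 1) (by omega)
      ⟨⟨bot_le, hlab⟩, f (i + 1), (hs i).of_cmp_eq rfl bot_le, reach_card_sub_one hf hs hN hlt⟩

lemma exists_derivation_of_defines [Finite V] [Nonempty V] (hk : 1 ≤ k)
    {φ : KExpr k V} (h : φ.Defines G) :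
    ∃ T : Fin (Nat.card V - k + 1 + 1) → Template V,
      IsDerivationOf T G ∧ ∀ i, (T i).HasLabels k := by
  obtain ⟨hw, hu, -⟩ := id h
  have hF := h.fits
  have hmem : ∀ v, v ∈ φ.verts := fun v => hu ▸ Set.mem_univ v
  have hr : Reach G k (Nat.card V - k + 1) ⟨⊥, ⊥⟩ := by
    refine reach_card_sub_add_one (f := φ.template hw hu) (N := φ.height) hk
      (fun i => ⟨fun _ _ => KExpr.GrpAt.cmpAt, φ.exists_labels hw i⟩)
      (fun i => ⟨fun _ _ => KExpr.CmpAt.mono i.le_succ, fun _ _ => KExpr.GrpAt.mono i.le_succ,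
        fun u v => hF.cmpAt_of_edge hw, fun u v w => hF.cmpAt_of_neighborhood hw,
        fun u v w x => hF.cmpAt_of_path hw⟩) ?_ ?_
    · exact eq_bot_iff.2 fun _ _ => KExpr.CmpAt.eq_of_zero
    · exact eq_top_iff.2 fun u v _ => KExpr.CmpAt.of_height_le le_rfl (hmem u) (hmem v)
  obtain ⟨S, h0, h1, h2, h3⟩ := hr.exists_sequence
  refine ⟨S, ⟨⟨?_, ?_, fun i => (h2 i).1, fun i => (h3 i).cmp_le, fun i => (h3 i).grp_le⟩,
    fun i => (h3 i).edge, fun i => (h3 i).neighborhood, fun i => (h3 i).path⟩,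
    fun i => (h2 i).2⟩
  · rw [ncard_classes_eq_card_iff, h0]
  · rw [ncard_classes_eq_one_iff, h1]

end Chains

/-- A finite infimum is attained, and an expression with `m ≤ k` labels becomes one with `k` labels
along the inclusion of `Fin m` in `Fin k`. -/
lemma cliqueWidth_le_iff {V : Type*} {G : SimpleGraph V} {k : ℕ} (hk : 1 ≤ k) :
    cliqueWidth G ≤ (k : ℕ∞) ↔ ∃ φ : KExpr k V, φ.Defines G := by
  constructor
  · intro h
    have hne : ((fun k : ℕ => (k : ℕ∞)) ''
        {k : ℕ | 0 < k ∧ ∃ φ : KExpr k V, φ.Defines G}).Nonempty := by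
      by_contra hcon
      rw [Set.not_nonempty_iff_eq_empty] at hcon
      rw [cliqueWidth, hcon, sInf_empty, top_le_iff] at h
      exact ENat.natCast_ne_top k h
    obtain ⟨m, ⟨-, φ, hφ⟩, hm⟩ := csInf_mem hne
    have hmk : m ≤ k := by
      rw [cliqueWidth, ← hm] at h
      exact Nat.cast_le.1 h
    exact ⟨_, hφ.mapLabels (Fin.castLEEmb hmk)⟩
  · rintro ⟨φ, hφ⟩
    exact sInf_le ⟨k, ⟨hk, φ, hφ⟩, rfl⟩

end CliqueWidthSAT

theorem mainTheorem2 {V : Type*} [Fintype V] [Nonempty V] [LinearOrder V] (G : SimpleGraph V) :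
    (∀ t : ℕ, 0 < t →
      (CliqueWidthSAT.CNF.Satisfiable (CliqueWidthSAT.derFormula G t) ↔
        CliqueWidthSAT.HasDerivation G t)) ∧
    (∀ k : ℕ, 1 ≤ k → k ≤ Fintype.card V →
      (CliqueWidthSAT.CNF.Satisfiable
          (CliqueWidthSAT.directFormula G k (Fintype.card V - k + 1)) ↔
        CliqueWidthSAT.cliqueWidth G ≤ (k : ℕ∞))) := by
  refine ⟨fun t _ => CliqueWidthSAT.derFormula_satisfiable_iff G t, fun k hk _ => ?_⟩
  rw [CliqueWidthSAT.directFormula_satisfiable_iff, CliqueWidthSAT.cliqueWidth_le_iff hk,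
    ← Nat.card_eq_fintype_card]
  constructor
  · rintro ⟨T, hD, hL⟩
    exact CliqueWidthSAT.exists_defines_of_derivation hD hL
  · rintro ⟨φ, hφ⟩
    exact CliqueWidthSAT.exists_derivation_of_defines hk hφ
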